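/- **Compactness lemma.** Conventions. A probability space $(\mathbb I,\mu)$ is *atomless standard* if $\mathbb I$ is a standard Borel space and $\mu$ is a probability measure without atoms. For a real Hilbert space $\mathcal H$, a kernel $\boldsymbol w\in L^\infty(\mathbb I\times\mathbb I;\mathcal H)$ has cut norm $$\|\boldsymbol w\|_{\square;\mathcal H}=\sup_{\|\boldsymbol e\|_{\mathcal H}\le 1,\ S,T\subset\mathbb I\text{ measurable}}\Big\langle \boldsymbol e,\int_{S\times T}\boldsymbol w\,d\mu\otimes d\mu\Big\rangle_{\mathcal H},$$ and for kernels $\boldsymbol w_1$ on $\mathbb I_1\times\mathbb I_1$, $\boldsymbol w_2$ on $\mathbb I_2\times\mathbb I_2$ the unlabeled cut distance is $$\delta_{\square;\mathcal H}(\boldsymbol w_1,\boldsymbol w_2)=\inf_\Phi\|\boldsymbol w_1-\boldsymbol w_2(\Phi(\cdot),\Phi(\cdot))\|_{\square;\mathcal H},$$ over all bijective measure-preserving maps $\Phi:\mathbb I_1\to\mathbb I_2$. If a Banach space $\mathcal B$ is continuously embedded in $\mathcal H$, then $L^\infty(\mathbb I\times\mathbb I;\mathcal B)$ denotes the $\mathcal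 B$-valued functions that are (a.e.-strongly) measurable as functions into $\mathcal H$ and whose $\mathcal B$-norm is essentially bounded. Write $\mathcal B_{\le r}$ for the closed ball of radius $r$ of $\mathcal B$ around $0$. Let $(\mathbb I_n,\mu_n)$, $n\in\mathbb N$, and $(\mathbb I,\nu)$ be atomless standard probability spaces (for instance $\mathbb I=[0,1]$). **(1)** Let $\mathcal B$ be a real Banach space compactly embedded into a separable real Hilbert space $\mathcal H$ (the embedding is linear, injective, and maps bounded sets to relatively compact sets). Let $\boldsymbol w_n\in L^\infty(\mathbb I_n\times\mathbb I_n;\mathcal B)$ satisfy $\|\boldsymbol w_n\|_{\mathcal B}\le w_{\max}<\infty$ a.e. for all $n$. Then there are a subsequence $(\boldsymbol w_{n_k})_k$ and a kernel $\boldsymbol w\in L^\infty(\mathbb I\times\mathbb I;\mathcal H)$ with values a.e. in the $\mathcal H$-closure of $\mathcal B_{\le w_{\max}}$ such that $$\lim_{k\to\infty}\delta_{\square;\mathcal H}(\boldsymbol w_{n_k},\boldsymbol w)=0.$$ If moreover $\mathcal B_{\le 1}$ is closed in $\mathcal H$ (equivalently, compact in $\mathcal H$), then $\boldsymbol w\in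 L^\infty(\mathbb I\times\mathbb I;\mathcal B)$, up to modification on a null set. **(2)** Let $\mathbb T=\mathbb R/\mathbb Z$, and let $H^{-1}(\mathbb T)$ be the Hilbert space of distributions with norm $\|f\|_{H^{-1}}^2=\sum_{m\in\mathbb Z}(1+4\pi^2m^2)^{-1}|\hat f(m)|^2$. For $w\in L^\infty(\mathbb I\times\mathbb I;\mathbb R)$ and measurable $X:\mathbb I\to\mathbb T$ put $$\boldsymbol w_{w,X}(\xi,\zeta)=\big(\delta_{X(\zeta)},\ w(\xi,\zeta)\,\delta_{X(\zeta)}\big)\in\mathcal H:=H^{-1}(\mathbb T)\oplus H^{-1}(\mathbb T).$$ Let $w^{(n)}\in L^\infty(\mathbb I_n\times\mathbb I_n;\mathbb R)$ with $|w^{(n)}|\le w_{\max}<\infty$ a.e. for all $n$, and let $X^{(n)}:\mathbb I_n\to\mathbb T$ be measurable. Then there are a subsequence $(n_k)_k$, a function $w\in L^\infty(\mathbb I\times\mathbb I;\mathbb R)$ and a measurable $X:\mathbb I\to\mathbb T$ such that $$\lim_{k\to\infty}\delta_{\square;\mathcal H}\big(\boldsymbol w_{w^{(n_k)},X^{(n_k)}},\boldsymbol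 w_{w,X}\big)=0.$$ Moreover every limit has this form: if $(n_k)_k$ is any strictly increasing sequence and $\boldsymbol u\in L^\infty(\mathbb I\times\mathbb I;\mathcal H)$ satisfies $\delta_{\square;\mathcal H}(\boldsymbol w_{w^{(n_k)},X^{(n_k)}},\boldsymbol u)\to0$, then $\boldsymbol u=\boldsymbol w_{w,X}$ a.e. for some $w\in L^\infty(\mathbb I\times\mathbb I;\mathbb R)$ and some measurable $X:\mathbb I\to\mathbb T$. -/

import Mathlib

open MeasureTheory Filter Topology
open scoped ENNReal

noncomputable section

namespace CutCompactness

/-- `w ∈ L^∞(Ω; B)` for a Banach space `B` regarded as a subspace of the Hilbert space `H` through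
the embedding `ι`: a `B`-valued function, measurable as a map into `H`, whose `B`-norm is
essentially bounded. (Strong measurability for the norm of `B` would exclude kernels such as
`ζ ↦ δ_ζ`, with `B` the non-separable space of measures with the total variation norm.) -/
structure MemLInfty {Ω B H : Type*} [MeasurableSpace Ω] [NormedAddCommGroup B] [NormedSpace ℝ B]
    [NormedAddCommGroup H] [NormedSpace ℝ H] (ι : B →L[ℝ] H) (P : Measure Ω) (w : Ω → B) :
    Prop where
  measurable : AEStronglyMeasurable (fun p => ι (w p)) P
  bounded : ∃ C : ℝ, ∀ᵐ p ∂P, ‖w p‖ ≤ C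

/-- The embedding `ι` of `B` into `H` is compact: it is injective and maps bounded sets to relatively
compact sets. -/
structure IsCompactEmbedding {B H : Type*} [NormedAddCommGroup B] [NormedSpace ℝ B]
    [NormedAddCommGroup H] [NormedSpace ℝ H] (ι : B →L[ℝ] H) : Prop where
  injective : Function.Injective ι
  compact : IsCompactOperator ι

section CutDistance

variable {I J H : Type*} [MeasurableSpace I] [MeasurableSpace J]
  [NormedAddCommGroup H] [InnerProductSpace ℝ H]

/-- The cut norm of an `H`-valued kernel on `I × J`: the supremum of
`⟪e, ∫_{S × T} w⟫` over `‖e‖ ≤ 1` and measurable `S ⊆ I`, `T ⊆ J`. The choice `e = 0` shows that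
the supremum is nonnegative, so that it may be taken in `[0, ∞]`. -/
def cutNorm (μ : Measure I) (ν : Measure J) (w : I × J → H) : ℝ≥0∞ :=
  ⨆ (e : H) (_ : ‖e‖ ≤ 1) (S : Set I) (_ : MeasurableSet S) (T : Set J) (_ : MeasurableSet T),
    ENNReal.ofReal (inner ℝ e (∫ p in S ×ˢ T, w p ∂(μ.prod ν)))

/-- The unlabeled cut distance between kernels `w₁` on `I × I` and `w₂` on `J × J`: the infimum of
the cut norm of `w₁ - w₂(Φ(·), Φ(·))` over all bijective measure-preserving maps `Φ : I → J`. -/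
def cutDist (μ : Measure I) (ν : Measure J) (w₁ : I × I → H) (w₂ : J × J → H) : ℝ≥0∞ :=
  ⨅ (Φ : I → J) (_ : Function.Bijective Φ) (_ : MeasurePreserving Φ μ ν),
    cutNorm μ μ (fun p => w₁ p - w₂ (Φ p.1, Φ p.2))

end CutDistance

/-- The Sobolev space `H^{-1}` of the torus `ℝ / ℤ`. A distribution `f` with Fourier coefficients
`f̂ m` is recorded by the square-summable sequence `(1 + 4 π² m²)^{-1/2} f̂ m`, so that
`‖f‖² = ∑ m, (1 + 4 π² m²)^{-1} |f̂ m|²`. -/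
abbrev HNegOne : Type := lp (fun _ : ℤ => ℂ) 2

/-- The `m`-th Fourier coefficient `∫ e^{-2 π i m x} dP(x)` of a measure on the torus. -/
def fourierCoeffMeasure (P : Measure UnitAddCircle) (m : ℤ) : ℂ :=
  ∫ x, fourier (-m) x ∂P

/-- The weighted Fourier coefficients that represent a measure as an element of `H^{-1}`. -/
def weightedCoeff (P : Measure UnitAddCircle) (m : ℤ) : ℂ :=
  ((√(1 + 4 * Real.pi ^ 2 * (m : ℝ) ^ 2))⁻¹ : ℝ) • fourierCoeffMeasure P m

theorem memlp_weightedCoeff (P : Measure UnitAddCircle) [IsFiniteMeasure P] :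
    Memℓp (weightedCoeff P) 2 := by
  rw [memℓp_gen_iff (by norm_num)]
  have h2 : (2 : ℝ≥0∞).toReal = (2 : ℕ) := by norm_num
  simp only [h2, Real.rpow_natCast]
  have hs : Summable fun m : ℤ => P.real Set.univ ^ 2 * (1 / (m : ℝ) ^ 2) :=
    (Real.summable_one_div_int_pow.mpr (by norm_num)).mul_left _
  refine hs.of_norm_bounded_eventually ?_
  have h0 : ∀ᶠ m : ℤ in cofinite, m ≠ 0 := by
    exact (Set.finite_singleton (0 : ℤ)).subset fun m hm => not_not.mp hm
  filter_upwards [h0] with m hm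
  have hm' : (0 : ℝ) < (m : ℝ) ^ 2 := by positivity
  have hc : ‖fourierCoeffMeasure P m‖ ≤ P.real Set.univ := by
    have := norm_integral_le_of_norm_le_const (μ := P) (C := 1)
      (f := fun x : UnitAddCircle => fourier (-m) x)
      (Eventually.of_forall fun x => by rw [fourier_apply, Circle.norm_coe])
    simpa [fourierCoeffMeasure] using this
  have hpi : (1 : ℝ) ≤ Real.pi := by linarith [Real.pi_gt_three]
  have hw : (0 : ℝ) < 1 + 4 * Real.pi ^ 2 * (m : ℝ) ^ 2 := by positivity
  rw [Real.norm_of_nonneg (by positivity), weightedCoeff, norm_smul, mul_pow, norm_inv,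
    Real.norm_of_nonneg (Real.sqrt_nonneg _), inv_pow, Real.sq_sqrt hw.le, mul_comm]
  have hle : (m : ℝ) ^ 2 ≤ 1 + 4 * Real.pi ^ 2 * (m : ℝ) ^ 2 := by
    nlinarith [mul_le_mul_of_nonneg_right (one_le_pow₀ hpi : 1 ≤ Real.pi ^ 2) hm'.le]
  rw [one_div]
  gcongr

/-- The canonical embedding of (nonnegative finite) measures on the torus into `H^{-1}`. -/
def measureToHNegOne (P : Measure UnitAddCircle) [IsFiniteMeasure P] : HNegOne :=
  ⟨weightedCoeff P, memlp_weightedCoeff P⟩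

/-- The kernel `(ξ, ζ) ↦ (δ_{X ζ}, w(ξ, ζ) δ_{X ζ})` associated with a pair `(w, X)`, with values in
the Hilbert space `H^{-1} ⊕ H^{-1}`. -/
def pairKernel {I : Type*} (w : I × I → ℝ) (X : I → UnitAddCircle) :
    I × I → PiLp 2 (fun _ : Fin 2 => HNegOne) :=
  fun p => WithLp.toLp 2
    ![measureToHNegOne (Measure.dirac (X p.2)), w p • measureToHNegOne (Measure.dirac (X p.2))]

end CutCompactness

end

/-! By the isomorphism theorem for atomless standard probability spaces, all kernels may be
transported to `J`, so it suffices that the kernels on `J × J` with values in a compact convex set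
`K` form a compact space under the cut distance. This space is complete: along a rapidly convergent
sequence, consecutive relabelings turn cut distances into cut norms, a weak `L²` limit along an
ultrafilter exists and keeps its values in `K`, and the cut norm is lower semicontinuous under weak
limits. It is totally bounded: greedy `L²`-approximation by combinations of rectangles (the weak
regularity lemma) brings a kernel close to a step kernel with boundedly many steps and values in a
finite-dimensional space, and after rearranging the partition into intervals the step kernels depend
on finitely many bounded parameters only.

For pairs `(w, X)`, the kernels converging in cut norm determine the positions: the marginal in `ζ`
of the first Fourier coefficient of `δ_{X ζ}` converges in `L¹`, and that coefficient embeds the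
torus into `ℂ`, so the positions converge a.e. along a subsequence. With the positions replaced by
their limit, the kernel is affine in the weight, and a weak limit of the weights gives the limit
kernel. -/

noncomputable section

namespace CutCompactness

section IsomorphismTheorem

open ProbabilityTheory unitInterval

/-- The distribution function of a law on the line, as a map to the unit interval. It pushes an
atomless law to Lebesgue measure. -/
def cdfUnit (P : Measure ℝ) (x : ℝ) : I := ⟨cdf P x, cdf_nonneg P x, cdf_le_one P x⟩

lemma monotone_cdfUnit (P : Measure ℝ) : Monotone (cdfUnit P) := fun _ _ h => monotone_cdf P h

section Line

variable (P : Measure ℝ) [IsProbabilityMeasure P] [NullSingletonClass P]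

lemma continuous_cdf : Continuous (cdf P) := by
  refine continuous_iff_continuousAt.mpr fun x => ?_
  rw [(cdf P).mono.continuousAt_iff_leftLim_eq_rightLim, StieltjesFunction.rightLim_eq]
  have hjump : ENNReal.ofReal (cdf P x - Function.leftLim (cdf P) x) = 0 := by
    rw [← (cdf P).measure_singleton x, measure_cdf, measure_singleton]
  exact ((cdf P).mono.leftLim_le le_rfl).antisymm (sub_nonpos.mp (ENNReal.ofReal_eq_zero.mp hjump))

lemma isGreatest_cdf_le_eq {t x : ℝ} (hx : IsGreatest {y | cdf P y ≤ t} x) : cdf P x = t := by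
  refine hx.1.antisymm (not_lt.mp fun hlt => ?_)
  obtain ⟨y, hy, hxy⟩ := (((continuous_cdf P).continuousAt.eventually_lt_const hlt).filter_mono
    nhdsWithin_le_nhds |>.and (self_mem_nhdsWithin (s := Set.Ioi x))).exists
  exact hxy.not_ge (hx.2 hy.le)

lemma measure_cdf_le {t : ℝ} (ht0 : 0 ≤ t) (ht1 : t ≤ 1) :
    P {x | cdf P x ≤ t} = ENNReal.ofReal t := by
  rcases ht1.eq_or_lt with rfl | ht1
  · simp [cdf_le_one]
  rcases {x | cdf P x ≤ t}.eq_empty_or_nonempty with hempty | hne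
  · have ht : ¬ 0 < t := fun ht =>
      let ⟨x, hx⟩ := ((tendsto_cdf_atBot P).eventually_lt_const ht).exists
      Set.eq_empty_iff_forall_notMem.mp hempty x hx.le
    simp [hempty, ENNReal.ofReal_of_nonpos (not_lt.mp ht)]
  · obtain ⟨b, hb⟩ := ((tendsto_cdf_atTop P).eventually_const_lt ht1).exists
    have hbdd : BddAbove {x | cdf P x ≤ t} :=
      ⟨b, fun x hx => not_lt.mp fun hbx => (hb.trans_le (monotone_cdf P hbx.le)).not_ge hx⟩
    have hgreatest := (isClosed_le (continuous_cdf P) continuous_const).isGreatest_csSup hne hbdd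
    have hset : {x | cdf P x ≤ t} = Set.Iic (sSup {x | cdf P x ≤ t}) :=
      Set.Subset.antisymm (fun x hx => hgreatest.2 hx)
        fun x hx => (monotone_cdf P hx).trans hgreatest.1
    rw [hset, ← ofReal_cdf, isGreatest_cdf_le_eq P hgreatest]

lemma measurePreserving_cdfUnit : MeasurePreserving (cdfUnit P) P volume := by
  have hmeas := (monotone_cdfUnit P).measurable
  have := Measure.isProbabilityMeasure_map (μ := P) hmeas.aemeasurable
  refine ⟨hmeas, Measure.ext_of_Iic _ _ fun t => ?_⟩
  rw [Measure.map_apply hmeas measurableSet_Iic, volume_Iic]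
  exact measure_cdf_le P t.2.1 t.2.2

lemma exists_injOn_cdfUnit :
    ∃ N : Set ℝ, MeasurableSet N ∧ P N = 0 ∧ Set.InjOn (cdfUnit P) Nᶜ := by
  have hfiber (q : ℚ) : MeasurableSet (cdfUnit P ⁻¹' {cdfUnit P q}) :=
    (monotone_cdfUnit P).measurable (measurableSet_singleton _)
  -- On an interval of constancy of the distribution function, every point but the left end point
  -- lies beyond a rational point of the same interval.
  refine ⟨⋃ q : ℚ, Set.Ioi (q : ℝ) ∩ cdfUnit P ⁻¹' {cdfUnit P q},
    .iUnion fun q => measurableSet_Ioi.inter (hfiber q),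
    measure_iUnion_null fun q => measure_mono_null Set.inter_subset_right ?_, ?_⟩
  · exact ((measurePreserving_cdfUnit P).measure_preimage
      (measurableSet_singleton _).nullMeasurableSet).trans (measure_singleton _)
  · have hmem {x y : ℝ} (hxy : x < y) (h : cdfUnit P x = cdfUnit P y) :
        y ∈ ⋃ q : ℚ, Set.Ioi (q : ℝ) ∩ cdfUnit P ⁻¹' {cdfUnit P q} := by
      obtain ⟨q, hxq, hqy⟩ := exists_rat_btwn hxy
      exact Set.mem_iUnion.mpr
        ⟨q, hqy, (h ▸ monotone_cdfUnit P hxq.le).antisymm (monotone_cdfUnit P hqy.le)⟩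
    intro x hx y hy h
    by_contra hne
    rcases lt_or_gt_of_ne hne with hlt | hlt
    exacts [hy (hmem hlt h), hx (hmem hlt h.symm)]

end Line

lemma uncountable_of_measure_ne_zero {X : Type*} [MeasurableSpace X] {μ : Measure X}
    [NullSingletonClass μ] (hμ : μ ≠ 0) : Uncountable X :=
  not_countable_iff.mp fun _ =>
    hμ (Measure.measure_univ_eq_zero.mp (Set.countable_univ.measure_zero μ))

open scoped symmDiff in
lemma measureReal_symmDiff_of_ae_eq_preimage_Iic {X : Type*} [MeasurableSpace X] {μ : Measure X}
    [IsFiniteMeasure μ] {θ : X → I}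
    (hθ : MeasurePreserving θ μ volume) {A B : Set X} {s t : I}
    (hA : A =ᵐ[μ] θ ⁻¹' Set.Iic s) (hB : B =ᵐ[μ] θ ⁻¹' Set.Iic t) :
    μ.real (A ∆ B) = |μ.real A - μ.real B| := by
  have hIic (r : I) : μ.real (θ ⁻¹' Set.Iic r) = r := by
    rw [hθ.measureReal_preimage measurableSet_Iic.nullMeasurableSet, measureReal_def, volume_Iic,
      ENNReal.toReal_ofReal r.2.1]
  have hIoc : Set.Iic s ∆ Set.Iic t = Set.uIoc s t := by
    rcases le_total s t with h | h
    · rw [symmDiff_of_le (Set.Iic_subset_Iic.mpr h), Set.uIoc_of_le h, Set.Iic_sdiff_Iic]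
    · rw [symmDiff_of_ge (Set.Iic_subset_Iic.mpr h), Set.uIoc_of_ge h, Set.Iic_sdiff_Iic]
  rw [measureReal_congr hA, measureReal_congr hB, measureReal_congr (hA.symmDiff hB), hIic, hIic,
    ← Set.preimage_symmDiff, hIoc,
    hθ.measureReal_preimage measurableSet_uIoc.nullMeasurableSet, measureReal_def, volume_uIoc,
    edist_comm, edist_dist, ENNReal.toReal_ofReal dist_nonneg]
  rfl

section StandardBorel

variable {X Y : Type*} [MeasurableSpace X] [StandardBorelSpace X] [MeasurableSpace Y]
  [StandardBorelSpace Y]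

lemma exists_measurableSet_null_not_countable [Uncountable X] (μ : Measure X) [SFinite μ] :
    ∃ C : Set X, MeasurableSet C ∧ μ C = 0 ∧ ¬ C.Countable := by
  let e : X ≃ᵐ ℝ × ℝ := PolishSpace.measurableEquivOfNotCountable
    (not_countable_iff.mpr ‹_›) (not_countable_iff.mpr inferInstance)
  let A : ℝ → Set X := fun x => (Prod.fst ∘ e) ⁻¹' {x}
  have hA (x : ℝ) : MeasurableSet (A x) :=
    (measurable_fst.comp e.measurable) (measurableSet_singleton x)
  have hpos : {x | 0 < μ (A x)}.Countable := Measure.countable_meas_pos_of_disjoint_iUnion hA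
    fun x y hxy => (Set.disjoint_singleton.mpr hxy).preimage _
  obtain ⟨x, hx⟩ : ∃ x, x ∉ {x | 0 < μ (A x)} := by
    by_contra! hall
    exact Cardinal.not_countable_real (hpos.mono fun x _ => hall x)
  refine ⟨A x, hA x, nonpos_iff_eq_zero.mp (not_lt.mp hx), fun hcount => ?_⟩
  refine Cardinal.not_countable_real ((hcount.image fun p => (e p).2).mono fun y _ => ?_)
  exact ⟨e.symm (x, y), by simp [A], by simp⟩

lemma exists_measurableEquiv_eqOn {G : X → Y} (hG : Measurable G) {A : Set X}
    (hA : MeasurableSet A) (hinj : Set.InjOn G A) (hAc : ¬ Aᶜ.Countable)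
    (hGAc : ¬ (G '' A)ᶜ.Countable) : ∃ θ : X ≃ᵐ Y, Set.EqOn θ G A := by
  classical
  have := hA.standardBorel
  have := hA.compl.standardBorel
  have hemb : MeasurableEmbedding (A.domRestrict G) :=
    (hG.comp measurable_subtype_coe).measurableEmbedding (Set.injOn_iff_injective.mp hinj)
  have := hemb.measurableSet_range.compl.standardBorel
  let e : (Aᶜ : Set X) ≃ᵐ ((Set.range (A.domRestrict G))ᶜ : Set Y) :=
    PolishSpace.measurableEquivOfNotCountable (mt Set.countable_coe_iff.mp hAc)
      (mt Set.countable_coe_iff.mp (by rwa [Set.range_domRestrict]))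
  refine ⟨(MeasurableEquiv.sumCompl hA).symm.trans ((hemb.equivRange.sumCongr e).trans
    (MeasurableEquiv.sumCompl hemb.measurableSet_range)), fun x hx => ?_⟩
  have hinl : (MeasurableEquiv.sumCompl hA).symm x = .inl ⟨x, hx⟩ :=
    Equiv.Set.sumCompl_symm_apply_of_mem hx
  rw [MeasurableEquiv.trans_apply, hinl]
  exact congrArg Subtype.val (hemb.equivRange_apply ⟨x, hx⟩)

lemma exists_measurableEquiv_of_injOn {μ : Measure X} [SFinite μ] [Uncountable X]
    {ν : Measure Y} [SFinite ν] [Uncountable Y]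
    {G : X → Y} (hG : MeasurePreserving G μ ν) {N : Set X} (hN : MeasurableSet N) (hN0 : μ N = 0)
    (hinj : Set.InjOn G Nᶜ) :
    ∃ θ : X ≃ᵐ Y, MeasurePreserving θ μ ν ∧ θ =ᵐ[μ] G := by
  -- Uncountable null sets are set aside on both sides, so that the bijection between the
  -- complements of the remaining sets exists by the Borel isomorphism theorem.
  obtain ⟨C, hC, hC0, hCc⟩ := exists_measurableSet_null_not_countable μ
  obtain ⟨D, hD, hD0, hDc⟩ := exists_measurableSet_null_not_countable ν
  have hA0 : μ (N ∪ C ∪ G ⁻¹' D) = 0 := measure_union_null (measure_union_null hN0 hC0)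
    ((hG.measure_preimage hD.nullMeasurableSet).trans hD0)
  obtain ⟨θ, hθ⟩ := exists_measurableEquiv_eqOn hG.measurable
    ((hN.union hC).union (hG.measurable hD)).compl
    (hinj.mono fun x hx hxN => hx (.inl (.inl hxN)))
    (fun h => hCc (h.mono fun x hx => not_not.mpr (.inl (.inr hx))))
    (fun h => hDc (h.mono (by rintro _ hy ⟨x, hx, rfl⟩; exact hx (.inr hy))))
  have hae : θ =ᵐ[μ] G := measure_mono_null (fun x hx => not_not.mp fun hxA => hx (hθ hxA)) hA0
  exact ⟨θ, ⟨θ.measurable, (Measure.map_congr hae).trans hG.map_eq⟩, hae⟩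

lemma exists_measurableEquiv_of_bijective {Φ : X → Y} (hΦ : Function.Bijective Φ)
    (hm : Measurable Φ) : ∃ θ : X ≃ᵐ Y, ⇑θ = Φ :=
  ⟨⟨Equiv.ofBijective Φ hΦ, hm, fun s hs => by
    rw [← Equiv.image_eq_preimage_symm]
    exact (hm.measurableEmbedding hΦ.1).measurableSet_image.mpr hs⟩, rfl⟩

variable (μ : Measure X) [IsProbabilityMeasure μ] [NullSingletonClass μ]

lemma exists_measurableEquiv_unitInterval_ae_eq_cdf {f : X → ℝ} (hf : Measurable f)
    (hinj : Function.Injective f) :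
    ∃ θ : X ≃ᵐ I, MeasurePreserving θ μ volume ∧ θ =ᵐ[μ] cdfUnit (μ.map f) ∘ f := by
  have := Measure.isProbabilityMeasure_map (μ := μ) hf.aemeasurable
  have : NullSingletonClass (μ.map f) := ⟨fun x => by
    rw [Measure.map_apply hf (measurableSet_singleton x)]
    exact (Set.subsingleton_singleton.preimage hinj).measure_zero μ⟩
  have := uncountable_of_measure_ne_zero (IsProbabilityMeasure.ne_zero μ)
  have := uncountable_of_measure_ne_zero (IsProbabilityMeasure.ne_zero (volume : Measure I))
  obtain ⟨N, hN, hN0, hNinj⟩ := exists_injOn_cdfUnit (μ.map f)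
  exact exists_measurableEquiv_of_injOn ((measurePreserving_cdfUnit _).comp ⟨hf, rfl⟩) (hf hN)
    (by rwa [← Measure.map_apply hf hN]) fun x hx y hy h => hinj (hNinj hx hy h)

lemma exists_measurableEquiv_sublevel_ae_eq {f : X → ℝ} (hf : Measurable f)
    (hinj : Function.Injective f) :
    ∃ θ : X ≃ᵐ I, MeasurePreserving θ μ volume ∧
      ∀ t : ℝ, ∃ s : I, {x | f x ≤ t} =ᵐ[μ] θ ⁻¹' Set.Iic s := by
  obtain ⟨θ, hθ, hθf⟩ := exists_measurableEquiv_unitInterval_ae_eq_cdf μ hf hinj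
  refine ⟨θ, hθ, fun t => ⟨cdfUnit (μ.map f) t, ae_eq_of_ae_subset_of_measure_ge ?_ ?_
    (measurableSet_le hf measurable_const).nullMeasurableSet (measure_ne_top _ _)⟩⟩
  · filter_upwards [hθf] with x hx hxt
    change θ x ≤ _
    rw [hx]
    exact monotone_cdfUnit _ hxt
  · have := Measure.isProbabilityMeasure_map (μ := μ) hf.aemeasurable
    rw [hθ.measure_preimage measurableSet_Iic.nullMeasurableSet, volume_Iic]
    change ENNReal.ofReal (cdf (μ.map f) t) ≤ _
    rw [ofReal_cdf, Measure.map_apply hf measurableSet_Iic]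
    rfl

lemma exists_measurableEquiv_nat_sublevel_ae_eq {h : X → ℕ} (hh : Measurable h) :
    ∃ θ : X ≃ᵐ I, MeasurePreserving θ μ volume ∧
      ∀ i : ℕ, ∃ s : I, {x | h x ≤ i} =ᵐ[μ] θ ⁻¹' Set.Iic s := by
  have hX := uncountable_of_measure_ne_zero (IsProbabilityMeasure.ne_zero μ)
  have : StandardBorelSpace (Set.Ioo (0 : ℝ) 1) := measurableSet_Ioo.standardBorel
  let g : X ≃ᵐ Set.Ioo (0 : ℝ) 1 := PolishSpace.measurableEquivOfNotCountable
    (not_countable_iff.mpr hX)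
    (mt Set.countable_coe_iff.mp (Cardinal.Real.Ioo_countable_iff.not.mpr (by norm_num)))
  -- The integer part of `h + g` is `h`, and its fractional part separates points.
  let f : X → ℝ := fun x => h x + g x
  have hfloor (x : X) : ⌊f x⌋₊ = h x :=
    (Nat.floor_eq_iff (add_nonneg (Nat.cast_nonneg _) (g x).2.1.le)).mpr
      ⟨le_add_of_nonneg_right (g x).2.1.le, add_lt_add_right (g x).2.2 _⟩
  have hf : Measurable f :=
    (measurable_from_nat.comp hh).add (measurable_subtype_coe.comp g.measurable)
  have hinj : Function.Injective f := fun x y hxy => g.injective <| Subtype.ext <| by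
    have hxy' : (h x : ℝ) + g x = h y + g y := hxy
    rwa [← hfloor x, ← hfloor y, hxy, add_right_inj] at hxy'
  obtain ⟨θ, hθ, hsublevel⟩ := exists_measurableEquiv_sublevel_ae_eq μ hf hinj
  refine ⟨θ, hθ, fun i => ?_⟩
  have hset : {x | h x ≤ i} = {x | f x ≤ i + 1} := by
    ext x
    change h x ≤ i ↔ (h x : ℝ) + g x ≤ i + 1
    have hg := (g x).2
    refine ⟨fun hi => add_le_add (by exact_mod_cast hi) hg.2.le, fun hi => ?_⟩
    have hlt : (h x : ℝ) < i + 1 := lt_of_lt_of_le (lt_add_of_pos_right _ hg.1) hi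
    exact Nat.lt_succ_iff.mp (by exact_mod_cast hlt)
  rw [hset]
  exact hsublevel (i + 1)

lemma exists_rearrangement (ν : Measure Y) [IsProbabilityMeasure ν] [NullSingletonClass ν]
    {M : ℕ} {h : X → Fin M} {h' : Y → Fin M} (hh : Measurable h) (hh' : Measurable h') :
    ∃ Φ : X ≃ᵐ Y, MeasurePreserving Φ μ ν ∧
      μ.real {x | h x ≠ h' (Φ x)} ≤ ∑ i, |μ.real {x | h x ≤ i} - ν.real {y | h' y ≤ i}| := by
  have hval : Measurable (Fin.val : Fin M → ℕ) := .of_discrete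
  obtain ⟨θ, hθ, hsublevel⟩ := exists_measurableEquiv_nat_sublevel_ae_eq μ (hval.comp hh)
  obtain ⟨θ', hθ', hsublevel'⟩ := exists_measurableEquiv_nat_sublevel_ae_eq ν (hval.comp hh')
  have hΦ : MeasurePreserving (θ.trans θ'.symm) μ ν := hθ'.symm.comp hθ
  refine ⟨θ.trans θ'.symm, hΦ, ?_⟩
  set Φ := θ.trans θ'.symm
  have hcover : {x | h x ≠ h' (Φ x)} ⊆ ⋃ i, symmDiff {x | h x ≤ i} (Φ ⁻¹' {y | h' y ≤ i}) := by
    intro x hx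
    rcases lt_or_gt_of_ne (show h x ≠ h' (Φ x) from hx) with hlt | hlt
    · exact Set.mem_iUnion.mpr ⟨h x, .inl ⟨le_refl (h x), hlt.not_ge⟩⟩
    · exact Set.mem_iUnion.mpr ⟨h' (Φ x), .inr ⟨le_refl (h' (Φ x)), hlt.not_ge⟩⟩
  refine (measureReal_mono hcover).trans ((measureReal_iUnion_fintype_le _).trans
    (Finset.sum_le_sum fun i _ => le_of_eq ?_))
  obtain ⟨s, hs⟩ := hsublevel i
  obtain ⟨s', hs'⟩ := hsublevel' i
  have hs'Φ : Φ ⁻¹' {y | h' y ≤ i} =ᵐ[μ] θ ⁻¹' Set.Iic s' := by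
    have hθΦ : θ' ∘ Φ = θ := by ext x; simp [Φ]
    rw [← hθΦ]
    exact hΦ.quasiMeasurePreserving.preimage_ae_eq hs'
  exact (measureReal_symmDiff_of_ae_eq_preimage_Iic hθ hs hs'Φ).trans (by
    rw [hΦ.measureReal_preimage (measurableSet_le hh' measurable_const).nullMeasurableSet]
    rfl)

end StandardBorel

end IsomorphismTheorem

section CutNorm

variable {I J H : Type*} [MeasurableSpace I] [MeasurableSpace J]
  [NormedAddCommGroup H] [InnerProductSpace ℝ H] {μ : Measure I} {ν : Measure J}

lemma iSup_ofReal_inner_eq_enorm (x : H) :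
    ⨆ (e : H) (_ : ‖e‖ ≤ 1), ENNReal.ofReal (inner ℝ e x) = ‖x‖ₑ := by
  apply le_antisymm
  · refine iSup₂_le fun e he => ?_
    rw [← ofReal_norm]
    exact ENNReal.ofReal_le_ofReal
      ((real_inner_le_norm e x).trans (mul_le_of_le_one_left (norm_nonneg x) he))
  · rcases eq_or_ne x 0 with rfl | hx
    · simp
    have hx' : ‖x‖ ≠ 0 := norm_ne_zero_iff.mpr hx
    refine le_iSup₂_of_le (‖x‖⁻¹ • x) ?_ ?_
    · rw [norm_smul, norm_inv, norm_norm, inv_mul_cancel₀ hx']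
    · rw [real_inner_smul_left, real_inner_self_eq_norm_sq, pow_two, inv_mul_cancel_left₀ hx',
        ofReal_norm]

lemma cutNorm_eq_iSup_enorm (w : I × J → H) :
    cutNorm μ ν w = ⨆ (S : Set I) (_ : MeasurableSet S) (T : Set J) (_ : MeasurableSet T),
      ‖∫ p in S ×ˢ T, w p ∂(μ.prod ν)‖ₑ := by
  apply le_antisymm
  · refine iSup₂_le fun e he => iSup₂_le fun S hS => iSup₂_le fun T hT => ?_
    refine le_iSup₂_of_le S hS (le_iSup₂_of_le T hT ?_)
    rw [← iSup_ofReal_inner_eq_enorm]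
    exact le_iSup₂_of_le e he le_rfl
  · refine iSup₂_le fun S hS => iSup₂_le fun T hT => ?_
    rw [← iSup_ofReal_inner_eq_enorm]
    exact iSup₂_le fun e he =>
      le_iSup₂_of_le e he (le_iSup₂_of_le S hS (le_iSup₂_of_le T hT le_rfl))

lemma enorm_setIntegral_le_cutNorm (w : I × J → H) {S : Set I} (hS : MeasurableSet S)
    {T : Set J} (hT : MeasurableSet T) :
    ‖∫ p in S ×ˢ T, w p ∂(μ.prod ν)‖ₑ ≤ cutNorm μ ν w := by
  rw [cutNorm_eq_iSup_enorm]
  exact le_iSup₂_of_le S hS (le_iSup₂_of_le T hT le_rfl)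

lemma cutNorm_le {w : I × J → H} {c : ℝ≥0∞}
    (h : ∀ S T, MeasurableSet S → MeasurableSet T →
      ‖∫ p in S ×ˢ T, w p ∂(μ.prod ν)‖ₑ ≤ c) : cutNorm μ ν w ≤ c := by
  rw [cutNorm_eq_iSup_enorm]
  exact iSup₂_le fun S hS => iSup₂_le fun T hT => h S T hS hT

lemma cutNorm_congr_ae {v w : I × J → H} (h : v =ᵐ[μ.prod ν] w) :
    cutNorm μ ν v = cutNorm μ ν w := by
  simp_rw [cutNorm_eq_iSup_enorm, integral_congr_ae (ae_restrict_of_ae h)]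

lemma cutNorm_zero : cutNorm μ ν (0 : I × J → H) = 0 := by
  simp [cutNorm_eq_iSup_enorm]

lemma cutNorm_add_le {v w : I × J → H} (hv : Integrable v (μ.prod ν))
    (hw : Integrable w (μ.prod ν)) :
    cutNorm μ ν (v + w) ≤ cutNorm μ ν v + cutNorm μ ν w := by
  refine cutNorm_le fun S T hS hT => ?_
  simp only [Pi.add_apply]
  rw [integral_add hv.integrableOn hw.integrableOn]
  exact (enorm_add_le _ _).trans (add_le_add (enorm_setIntegral_le_cutNorm v hS hT)
    (enorm_setIntegral_le_cutNorm w hS hT))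

lemma cutNorm_sub_comm (v w : I × J → H) : cutNorm μ ν (v - w) = cutNorm μ ν (w - v) := by
  rw [← neg_sub]
  simp only [cutNorm_eq_iSup_enorm, Pi.neg_apply, integral_neg, enorm_neg]

lemma cutNorm_sub_le {u v w : I × J → H} (hu : Integrable u (μ.prod ν))
    (hv : Integrable v (μ.prod ν)) (hw : Integrable w (μ.prod ν)) :
    cutNorm μ ν (u - w) ≤ cutNorm μ ν (u - v) + cutNorm μ ν (v - w) :=
  (sub_add_sub_cancel u v w) ▸ cutNorm_add_le (hu.sub hv) (hv.sub hw)

lemma cutNorm_le_lintegral (w : I × J → H) : cutNorm μ ν w ≤ ∫⁻ p, ‖w p‖ₑ ∂(μ.prod ν) :=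
  cutNorm_le fun _ _ _ _ =>
    (enorm_integral_le_lintegral_enorm _).trans (setLIntegral_le_lintegral _ _)

lemma cutNorm_le_of_ae_norm_le [IsProbabilityMeasure μ] [IsProbabilityMeasure ν] {w : I × J → H}
    {c : ℝ} (h : ∀ᵐ p ∂(μ.prod ν), ‖w p‖ ≤ c) : cutNorm μ ν w ≤ ENNReal.ofReal c := by
  refine (cutNorm_le_lintegral w).trans ?_
  calc ∫⁻ p, ‖w p‖ₑ ∂(μ.prod ν) ≤ ∫⁻ _, ENNReal.ofReal c ∂(μ.prod ν) :=
        lintegral_mono_ae <| h.mono fun _ hp =>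
          (ofReal_norm _).symm.trans_le (ENNReal.ofReal_le_ofReal hp)
    _ = ENNReal.ofReal c := by simp

lemma cutNorm_clm_comp_le {E : Type*} [NormedAddCommGroup E] [InnerProductSpace ℝ E]
    [CompleteSpace E] [CompleteSpace H] (L : E →L[ℝ] H) {w : I × J → E}
    (hw : Integrable w (μ.prod ν)) : cutNorm μ ν (L ∘ w) ≤ ‖L‖ₑ * cutNorm μ ν w := by
  refine cutNorm_le fun S T hS hT => ?_
  rw [Function.comp_def, L.integral_comp_comm hw.integrableOn]
  exact (L.le_opENorm _).trans (mul_le_mul_right (enorm_setIntegral_le_cutNorm w hS hT) _)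

lemma cutNorm_comp [SFinite μ] [SFinite ν] {I' J' : Type*} [MeasurableSpace I']
    [MeasurableSpace J'] {μ' : Measure I'} {ν' : Measure J'} [SFinite μ'] [SFinite ν']
    {θ : I ≃ᵐ I'} (hθ : MeasurePreserving θ μ μ') {η : J ≃ᵐ J'} (hη : MeasurePreserving η ν ν')
    (w : I' × J' → H) : cutNorm μ ν (w ∘ Prod.map θ η) = cutNorm μ' ν' w := by
  have hpreimage (S : Set I') (T : Set J') :
      ∫ p in (θ ⁻¹' S) ×ˢ (η ⁻¹' T), (w ∘ Prod.map θ η) p ∂(μ.prod ν) =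
        ∫ p in S ×ˢ T, w p ∂(μ'.prod ν') :=
    (hθ.prod hη).setIntegral_preimage_emb (θ.prodCongr η).measurableEmbedding w (S ×ˢ T)
  refine le_antisymm (cutNorm_le fun S T hS hT => ?_) (cutNorm_le fun S T hS hT => ?_)
  · have hS' : θ ⁻¹' (θ.symm ⁻¹' S) = S := θ.toEquiv.preimage_symm_preimage S
    have hT' : η ⁻¹' (η.symm ⁻¹' T) = T := η.toEquiv.preimage_symm_preimage T
    rw [← hS', ← hT', hpreimage]
    exact enorm_setIntegral_le_cutNorm w (θ.symm.measurable hS) (η.symm.measurable hT)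
  · rw [← hpreimage]
    exact enorm_setIntegral_le_cutNorm _ (θ.measurable hS) (η.measurable hT)

lemma cutNorm_sub_comp_symm [SFinite μ] [SFinite ν] {θ : I ≃ᵐ J} (hθ : MeasurePreserving θ μ ν)
    (w₁ : I × I → H) (w₂ : J × J → H) :
    cutNorm ν ν (w₁ ∘ Prod.map θ.symm θ.symm - w₂) = cutNorm μ μ (w₁ - w₂ ∘ Prod.map θ θ) := by
  rw [← cutNorm_comp hθ hθ]
  congr 1
  ext p
  simp [Prod.map]

end CutNorm

section CutDist

variable {I J L H : Type*} [MeasurableSpace I] [MeasurableSpace J] [MeasurableSpace L]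
  [NormedAddCommGroup H] [InnerProductSpace ℝ H] {μ : Measure I} {ν : Measure J} {ρ : Measure L}

lemma cutDist_le_cutNorm {θ : I ≃ᵐ J} (hθ : MeasurePreserving θ μ ν) (w₁ : I × I → H)
    (w₂ : J × J → H) : cutDist μ ν w₁ w₂ ≤ cutNorm μ μ (w₁ - w₂ ∘ Prod.map θ θ) :=
  iInf_le_of_le θ (iInf₂_le_of_le θ.bijective hθ le_rfl)

lemma exists_cutNorm_lt [StandardBorelSpace I] [StandardBorelSpace J] {w₁ : I × I → H}
    {w₂ : J × J → H} {c : ℝ≥0∞} (h : cutDist μ ν w₁ w₂ < c) :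
    ∃ θ : I ≃ᵐ J, MeasurePreserving θ μ ν ∧ cutNorm μ μ (w₁ - w₂ ∘ Prod.map θ θ) < c := by
  simp only [cutDist, iInf_lt_iff] at h
  obtain ⟨Φ, hΦ, hm, hlt⟩ := h
  obtain ⟨θ, rfl⟩ := exists_measurableEquiv_of_bijective hΦ hm.measurable
  exact ⟨θ, hm, hlt⟩

lemma cutDist_le_cutNorm_sub (w₁ w₂ : I × I → H) : cutDist μ μ w₁ w₂ ≤ cutNorm μ μ (w₁ - w₂) :=
  cutDist_le_cutNorm (θ := .refl I) (.id μ) w₁ w₂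

lemma cutDist_self (w : I × I → H) : cutDist μ μ w w = 0 :=
  nonpos_iff_eq_zero.mp <| (cutDist_le_cutNorm_sub w w).trans_eq <|
    (congrArg (cutNorm μ μ) (sub_self w)).trans cutNorm_zero

lemma cutDist_congr_right [SFinite μ] [SFinite ν] (v : I × I → H) {w w' : J × J → H}
    (h : w =ᵐ[ν.prod ν] w') : cutDist μ ν v w = cutDist μ ν v w' := by
  refine iInf_congr fun Φ => iInf_congr fun _ => iInf_congr fun hΦ => cutNorm_congr_ae ?_
  filter_upwards [(hΦ.prod hΦ).quasiMeasurePreserving.ae_eq_comp h] with p hp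
  exact congrArg (v p - ·) hp

lemma cutDist_comm_le [StandardBorelSpace I] [StandardBorelSpace J] [SFinite μ] [SFinite ν]
    (w₁ : I × I → H) (w₂ : J × J → H) : cutDist ν μ w₂ w₁ ≤ cutDist μ ν w₁ w₂ := by
  refine le_of_forall_gt_imp_ge_of_dense fun c hc => ?_
  obtain ⟨θ, hθ, hlt⟩ := exists_cutNorm_lt hc
  refine (cutDist_le_cutNorm hθ.symm w₂ w₁).trans ?_
  rw [cutNorm_sub_comm, cutNorm_sub_comp_symm hθ]
  exact hlt.le

lemma cutDist_triangle [StandardBorelSpace I] [StandardBorelSpace J] [StandardBorelSpace L]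
    [SFinite μ] [SFinite ν] [SFinite ρ] {w₁ : I × I → H} {w₂ : J × J → H} {w₃ : L × L → H}
    (h₁ : Integrable w₁ (μ.prod μ)) (h₂ : Integrable w₂ (ν.prod ν))
    (h₃ : Integrable w₃ (ρ.prod ρ)) :
    cutDist μ ρ w₁ w₃ ≤ cutDist μ ν w₁ w₂ + cutDist ν ρ w₂ w₃ := by
  refine ENNReal.le_of_forall_pos_le_add fun ε hε htop => ?_
  have hε2 : (ε / 2 : ℝ≥0∞) ≠ 0 := by simp [hε.ne']
  obtain ⟨h₁₂, h₂₃⟩ := ENNReal.add_lt_top.mp htop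
  obtain ⟨θ, hθ, hltθ⟩ := exists_cutNorm_lt (ENNReal.lt_add_right h₁₂.ne hε2)
  obtain ⟨η, hη, hltη⟩ := exists_cutNorm_lt (ENNReal.lt_add_right h₂₃.ne hε2)
  have h₂θ : Integrable (w₂ ∘ Prod.map θ θ) (μ.prod μ) :=
    (hθ.prod hθ).integrable_comp_of_integrable h₂
  have hθη : MeasurePreserving (θ.trans η) μ ρ := hη.comp hθ
  have h₃θ : Integrable (w₃ ∘ Prod.map (θ.trans η) (θ.trans η)) (μ.prod μ) :=
    (hθη.prod hθη).integrable_comp_of_integrable h₃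
  calc cutDist μ ρ w₁ w₃
      ≤ cutNorm μ μ (w₁ - w₃ ∘ Prod.map (θ.trans η) (θ.trans η)) :=
        cutDist_le_cutNorm hθη w₁ w₃
    _ ≤ cutNorm μ μ (w₁ - w₂ ∘ Prod.map θ θ) +
        cutNorm μ μ ((w₂ - w₃ ∘ Prod.map η η) ∘ Prod.map θ θ) := cutNorm_sub_le h₁ h₂θ h₃θ
    _ ≤ (cutDist μ ν w₁ w₂ + ε / 2) + (cutDist ν ρ w₂ w₃ + ε / 2) :=
        add_le_add hltθ.le ((cutNorm_comp hθ hθ _).trans_le hltη.le)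
    _ = cutDist μ ν w₁ w₂ + cutDist ν ρ w₂ w₃ + ε := by
        rw [add_add_add_comm, ENNReal.add_halves]

end CutDist

section KernelsIn

variable {I J H : Type*} [MeasurableSpace I] [MeasurableSpace J] [NormedAddCommGroup H]
  {μ : Measure I} {ν : Measure J} {K : TopologicalSpace.Compacts H}

/-- The measurable kernels on `J × J` with values a.e. in a compact set `K`. This is the space whose
compactness under the cut distance is proved; it is only a pseudometric space, since kernels that
differ by a relabeling are not identified. -/
structure KernelsIn (ν : Measure J) (K : TopologicalSpace.Compacts H) where
  toFun : J × J → H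
  aestronglyMeasurable : AEStronglyMeasurable toFun (ν.prod ν)
  ae_mem : ∀ᵐ p ∂(ν.prod ν), toFun p ∈ K

namespace KernelsIn

instance : CoeFun (KernelsIn ν K) fun _ => J × J → H := ⟨toFun⟩

lemma memLp [IsFiniteMeasure ν] (w : KernelsIn ν K) (q : ℝ≥0∞) : MemLp w q (ν.prod ν) :=
  let ⟨C, hC⟩ := K.isCompact.isBounded.exists_norm_le
  .of_bound w.aestronglyMeasurable C (w.ae_mem.mono fun _ hp => hC _ hp)

lemma integrable [IsFiniteMeasure ν] (w : KernelsIn ν K) : Integrable w (ν.prod ν) :=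
  (w.memLp 1).integrable le_rfl

/-- The kernel relabeled along a measure-preserving map. -/
def comap [SFinite μ] [SFinite ν] {θ : I → J} (hθ : MeasurePreserving θ μ ν)
    (w : KernelsIn ν K) : KernelsIn μ K where
  toFun := w ∘ Prod.map θ θ
  aestronglyMeasurable := w.aestronglyMeasurable.comp_measurePreserving (hθ.prod hθ)
  ae_mem := (hθ.prod hθ).quasiMeasurePreserving.ae w.ae_mem

variable [InnerProductSpace ℝ H] [StandardBorelSpace J] [IsFiniteMeasure ν]

instance : PseudoEMetricSpace (KernelsIn ν K) where
  edist v w := cutDist ν ν v w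
  edist_self w := cutDist_self w
  edist_comm _ _ := le_antisymm (cutDist_comm_le _ _) (cutDist_comm_le _ _)
  edist_triangle u v w := cutDist_triangle u.integrable v.integrable w.integrable

end KernelsIn

end KernelsIn

section TendstoWeakL2

variable {Ω ι H : Type*} [MeasurableSpace Ω] {P : Measure Ω}
  [NormedAddCommGroup H] [InnerProductSpace ℝ H]

/-- Weak convergence in `L²(P; H)`, tested against all `g ∈ L²(P; H)`, for functions rather than for
their classes in `Lp`. -/
def TendstoWeakL2 (P : Measure Ω) (w : ι → Ω → H) (l : Filter ι) (u : Ω → H) : Prop :=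
  ∀ g : Ω → H, MemLp g 2 P →
    Tendsto (fun i => ∫ p, inner ℝ (g p) (w i p) ∂P) l (𝓝 (∫ p, inner ℝ (g p) (u p) ∂P))

lemma inner_toLp_eq_integral {g w : Ω → H} (hg : MemLp g 2 P) (hw : MemLp w 2 P) :
    inner ℝ (hg.toLp g) (hw.toLp w) = ∫ p, inner ℝ (g p) (w p) ∂P := by
  rw [L2.inner_def]
  refine integral_congr_ae ?_
  filter_upwards [hg.coeFn_toLp, hw.coeFn_toLp] with p hgp hwp
  rw [hgp, hwp]

lemma exists_tendsto_inner [CompleteSpace H] (𝓤 : Ultrafilter ι) {x : ι → H} {R : ℝ}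
    (hx : ∀ i, ‖x i‖ ≤ R) :
    ∃ y : H, ∀ g : H, Tendsto (fun i => inner ℝ g (x i)) 𝓤 (𝓝 (inner ℝ g y)) := by
  let F : ι → WeakDual ℝ H := fun i => StrongDual.toWeakDual (InnerProductSpace.toDual ℝ H (x i))
  have hF (i : ι) : F i ∈ WeakDual.toStrongDual ⁻¹' Metric.closedBall (0 : StrongDual ℝ H) R :=
    mem_closedBall_zero_iff.mpr (((InnerProductSpace.toDual ℝ H).norm_map (x i)).trans_le (hx i))
  obtain ⟨f, -, hf⟩ := isCompact_iff_ultrafilter_le_nhds'.mp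
    (WeakDual.isCompact_closedBall (0 : StrongDual ℝ H) R) (𝓤.map F)
    (Eventually.of_forall (f := (𝓤 : Filter ι)) hF)
  refine ⟨(InnerProductSpace.toDual ℝ H).symm (WeakDual.toStrongDual f), fun g => ?_⟩
  have hfg : Tendsto (fun i => F i g) 𝓤 (𝓝 (f g)) :=
    ((WeakDual.eval_continuous g).tendsto f).comp hf
  simp only [real_inner_comm _ g, InnerProductSpace.toDual_symm_apply]
  exact hfg

theorem exists_tendstoWeakL2 [CompleteSpace H] (𝓤 : Ultrafilter ι) {w : ι → Ω → H}
    (hw : ∀ i, MemLp (w i) 2 P) {R : ℝ} (hR : ∀ i, (eLpNorm (w i) 2 P).toReal ≤ R) :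
    ∃ u, MemLp u 2 P ∧ TendstoWeakL2 P w 𝓤 u := by
  obtain ⟨u, hu⟩ := exists_tendsto_inner 𝓤 (x := fun i => (hw i).toLp (w i))
    fun i => (Lp.norm_toLp _ _).trans_le (hR i)
  refine ⟨u, Lp.memLp u, fun g hg => ?_⟩
  have hgu := hu (hg.toLp g)
  rw [← Lp.toLp_coeFn u (Lp.memLp u)] at hgu
  simpa only [inner_toLp_eq_integral] using hgu

lemma integral_inner_indicator [CompleteSpace H] {w : Ω → H} (hw : Integrable w P) {A : Set Ω}
    (hA : MeasurableSet A) (e : H) :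
    ∫ p, inner ℝ (A.indicator (fun _ => e) p) (w p) ∂P = inner ℝ e (∫ p in A, w p ∂P) := by
  rw [← integral_inner hw.integrableOn, ← integral_indicator hA]
  refine integral_congr_ae (Eventually.of_forall fun p => ?_)
  by_cases hp : p ∈ A <;> simp [hp]

lemma TendstoWeakL2.tendsto_inner_setIntegral [CompleteSpace H] [IsFiniteMeasure P]
    {w : ι → Ω → H} {l : Filter ι} {u : Ω → H} (h : TendstoWeakL2 P w l u)
    (hw : ∀ i, Integrable (w i) P) (hu : Integrable u P) {A : Set Ω} (hA : MeasurableSet A)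
    (e : H) :
    Tendsto (fun i => inner ℝ e (∫ p in A, w i p ∂P)) l (𝓝 (inner ℝ e (∫ p in A, u p ∂P))) := by
  simpa only [integral_inner_indicator (hw _) hA, integral_inner_indicator hu hA]
    using h _ ((memLp_const e).indicator hA)

lemma isClosed_setOf_ae_mem {E : Type*} [NormedAddCommGroup E] {q : ℝ≥0∞} [Fact (1 ≤ q)]
    {K : Set E} (hK : IsClosed K) : IsClosed {f : Lp E q P | ∀ᵐ p ∂P, f p ∈ K} := by
  refine isSeqClosed_iff_isClosed.mp fun f u hf hu => ?_
  obtain ⟨φ, -, hφ⟩ := (tendstoInMeasure_of_tendsto_Lp hu).exists_seq_tendsto_ae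
  filter_upwards [hφ, ae_all_iff.mpr hf] with p hp hfp
  exact hK.mem_of_tendsto hp (Eventually.of_forall fun i => hfp (φ i))

lemma convex_setOf_ae_mem {E : Type*} [NormedAddCommGroup E] [NormedSpace ℝ E] {q : ℝ≥0∞}
    [Fact (1 ≤ q)] {K : Set E} (hK : Convex ℝ K) :
    Convex ℝ {f : Lp E q P | ∀ᵐ p ∂P, f p ∈ K} := by
  intro f hf g hg a b ha hb hab
  filter_upwards [hf, hg, Lp.coeFn_add (a • f) (b • g), Lp.coeFn_smul a f, Lp.coeFn_smul b g]
    with p hfp hgp hadd hsmulf hsmulg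
  rw [hadd, Pi.add_apply, hsmulf, hsmulg]
  exact hK hfp hgp ha hb hab

-- Mazur: a closed convex subset of `L²` is weakly closed, by Hahn-Banach separation.
lemma TendstoWeakL2.ae_mem [CompleteSpace H] {w : ι → Ω → H} {l : Filter ι} [l.NeBot]
    {u : Ω → H} (h : TendstoWeakL2 P w l u) (hw : ∀ i, MemLp (w i) 2 P) (hu : MemLp u 2 P)
    {K : Set H} (hK : IsClosed K) (hconv : Convex ℝ K) (hwK : ∀ i, ∀ᵐ p ∂P, w i p ∈ K) :
    ∀ᵐ p ∂P, u p ∈ K := by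
  have ae_mem_toLp {f : Ω → H} (hf : MemLp f 2 P) :
      hf.toLp f ∈ {f : Lp H 2 P | ∀ᵐ p ∂P, f p ∈ K} ↔ ∀ᵐ p ∂P, f p ∈ K :=
    eventually_congr (hf.coeFn_toLp.mono fun p hp => by rw [hp])
  rw [← ae_mem_toLp hu]
  by_contra hmem
  obtain ⟨f, s, hfs, hsf⟩ := geometric_hahn_banach_closed_point (convex_setOf_ae_mem hconv)
    (isClosed_setOf_ae_mem hK) hmem
  set g : Lp H 2 P := (InnerProductSpace.toDual ℝ (Lp H 2 P)).symm f
  have hfg {v : Ω → H} (hv : MemLp v 2 P) : ∫ p, inner ℝ (g p) (v p) ∂P = f (hv.toLp v) := by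
    rw [← inner_toLp_eq_integral (Lp.memLp g) hv, Lp.toLp_coeFn,
      InnerProductSpace.toDual_symm_apply]
  have hlim := h g (Lp.memLp g)
  simp only [hfg (hw _), hfg hu] at hlim
  exact (le_of_tendsto hlim (Eventually.of_forall fun i =>
    (hfs _ ((ae_mem_toLp (hw i)).mpr (hwK i))).le)).not_gt hsf

end TendstoWeakL2

section Completeness

variable {I J ι H : Type*} [MeasurableSpace I] [MeasurableSpace J] [NormedAddCommGroup H]
  [InnerProductSpace ℝ H] {μ : Measure I} {ν : Measure J}

theorem TendstoWeakL2.cutNorm_sub_le_liminf [CompleteSpace H] [IsFiniteMeasure μ]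
    [IsFiniteMeasure ν] {w : ι → I × J → H} {l : Filter ι} [l.NeBot] {u v : I × J → H}
    (h : TendstoWeakL2 (μ.prod ν) w l u) (hw : ∀ i, Integrable (w i) (μ.prod ν))
    (hu : Integrable u (μ.prod ν)) (hv : Integrable v (μ.prod ν)) :
    cutNorm μ ν (v - u) ≤ liminf (fun i => cutNorm μ ν (v - w i)) l := by
  refine iSup₂_le fun e he => iSup₂_le fun S hS => iSup₂_le fun T hT => ?_
  have hlim : Tendsto (fun i => ENNReal.ofReal
      (inner ℝ e (∫ p in S ×ˢ T, (v - w i) p ∂(μ.prod ν)))) l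
      (𝓝 (ENNReal.ofReal (inner ℝ e (∫ p in S ×ˢ T, (v - u) p ∂(μ.prod ν))))) := by
    refine ENNReal.tendsto_ofReal ?_
    simp only [integral_sub' hv.integrableOn (hw _).integrableOn,
      integral_sub' hv.integrableOn hu.integrableOn, inner_sub_right]
    exact (h.tendsto_inner_setIntegral hw hu (hS.prod hT) e).const_sub _
  rw [← hlim.liminf_eq]
  exact liminf_le_liminf (Eventually.of_forall fun i =>
    le_iSup₂_of_le e he (le_iSup₂_of_le S hS (le_iSup₂_of_le T hT le_rfl)))

lemma cutNorm_sub_le_sum {v : ℕ → I × J → H} (hv : ∀ n, Integrable (v n) (μ.prod ν)) (n k : ℕ) :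
    cutNorm μ ν (v n - v (n + k)) ≤
      ∑ i ∈ Finset.range k, cutNorm μ ν (v (n + i) - v (n + i + 1)) := by
  induction k with
  | zero => simp [cutNorm_zero]
  | succ k ih =>
    rw [Finset.sum_range_succ]
    exact (cutNorm_sub_le (hv n) (hv (n + k)) (hv (n + k + 1))).trans (by gcongr)

lemma cutNorm_sub_le_two_mul_inv_two_pow {v : ℕ → I × J → H}
    (hv : ∀ n, Integrable (v n) (μ.prod ν))
    (h : ∀ n, cutNorm μ ν (v n - v (n + 1)) ≤ 2⁻¹ ^ n) {n m : ℕ} (hnm : n ≤ m) :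
    cutNorm μ ν (v n - v m) ≤ 2 * 2⁻¹ ^ n := by
  obtain ⟨k, rfl⟩ := Nat.exists_eq_add_of_le hnm
  calc cutNorm μ ν (v n - v (n + k))
      ≤ ∑ i ∈ Finset.range k, 2⁻¹ ^ (n + i) :=
        (cutNorm_sub_le_sum hv n k).trans (Finset.sum_le_sum fun i _ => h (n + i))
    _ = 2⁻¹ ^ n * ∑ i ∈ Finset.range k, 2⁻¹ ^ i := by simp only [pow_add, Finset.mul_sum]
    _ ≤ 2⁻¹ ^ n * ∑' i : ℕ, 2⁻¹ ^ i := by gcongr; exact ENNReal.sum_le_tsum _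
    _ = 2 * 2⁻¹ ^ n := by rw [ENNReal.tsum_geometric_two, mul_comm]

lemma exists_relabelings_cutNorm_sub_le [StandardBorelSpace J] [SFinite ν] {w : ℕ → J × J → H}
    {ε : ℕ → ℝ≥0∞} (h : ∀ n, cutDist ν ν (w n) (w (n + 1)) < ε n) :
    ∃ Ψ : ℕ → J ≃ᵐ J, (∀ n, MeasurePreserving (Ψ n) ν ν) ∧ ∀ n,
      cutNorm ν ν (w n ∘ Prod.map (Ψ n) (Ψ n) - w (n + 1) ∘ Prod.map (Ψ (n + 1)) (Ψ (n + 1)))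
        ≤ ε n := by
  choose θ hθ hlt using fun n => exists_cutNorm_lt (h n)
  let Ψ : ℕ → J ≃ᵐ J := fun n => Nat.rec (MeasurableEquiv.refl J) (fun n e => e.trans (θ n)) n
  have hΨ (n : ℕ) : MeasurePreserving (Ψ n) ν ν := by
    induction n with
    | zero => exact .id ν
    | succ n ih => exact (hθ n).comp ih
  exact ⟨Ψ, hΨ, fun n => (cutNorm_comp (hΨ n) (hΨ n)
    (w n - w (n + 1) ∘ Prod.map (θ n) (θ n))).trans_le (hlt n).le⟩

variable {K : TopologicalSpace.Compacts H}

lemma KernelsIn.exists_tendstoWeakL2 [CompleteSpace H] [IsFiniteMeasure ν]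
    (hconv : Convex ℝ (K : Set H)) (𝓤 : Ultrafilter ι) (w : ι → KernelsIn ν K) :
    ∃ u : KernelsIn ν K, TendstoWeakL2 (ν.prod ν) (fun i => w i) 𝓤 u := by
  obtain ⟨C, hC⟩ := K.isCompact.isBounded.exists_norm_le
  obtain ⟨u, hu, hwu⟩ := CutCompactness.exists_tendstoWeakL2 𝓤 (fun i => (w i).memLp 2)
    (R := ((ν.prod ν) Set.univ ^ (2 : ℝ≥0∞).toReal⁻¹ * ENNReal.ofReal C).toReal) fun i =>
      ENNReal.toReal_mono (by finiteness)
        (eLpNorm_le_of_ae_bound ((w i).ae_mem.mono fun p hp => hC _ hp))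
  exact ⟨⟨u, hu.1, hwu.ae_mem (fun i => (w i).memLp 2) hu K.isCompact.isClosed hconv
    fun i => (w i).ae_mem⟩, hwu⟩

theorem completeSpace_kernelsIn [StandardBorelSpace J] [IsFiniteMeasure ν] [CompleteSpace H]
    (hconv : Convex ℝ (K : Set H)) : CompleteSpace (KernelsIn ν K) := by
  refine EMetric.complete_of_convergent_controlled_sequences (fun n => 2⁻¹ ^ n)
    (fun n => ENNReal.pow_pos (by simp) n) fun w hw => ?_
  obtain ⟨Ψ, hΨ, hle⟩ := exists_relabelings_cutNorm_sub_le
    fun n => hw n n (n + 1) le_rfl n.le_succ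
  let v (n : ℕ) : KernelsIn ν K := (w n).comap (hΨ n)
  obtain ⟨u, hu⟩ := KernelsIn.exists_tendstoWeakL2 hconv (hyperfilter ℕ) v
  have hvu (n : ℕ) : cutNorm ν ν ((v n).toFun - u.toFun) ≤ 2 * 2⁻¹ ^ n := by
    refine (hu.cutNorm_sub_le_liminf (fun i => (v i).integrable) u.integrable
      (v n).integrable).trans (liminf_le_of_frequently_le' (Eventually.frequently ?_))
    filter_upwards [Nat.hyperfilter_le_atTop (eventually_ge_atTop n)] with m hm
    exact cutNorm_sub_le_two_mul_inv_two_pow (fun n => (v n).integrable) hle hm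
  have hlim : Tendsto (fun n : ℕ => (2 : ℝ≥0∞) * 2⁻¹ ^ n) atTop (𝓝 0) := by
    simpa using ENNReal.Tendsto.const_mul (a := 2)
      (ENNReal.tendsto_pow_atTop_nhds_zero_of_lt_one (r := 2⁻¹) (by simp)) (Or.inr (by simp))
  refine ⟨u, tendsto_iff_edist_tendsto_0.mpr ?_⟩
  refine tendsto_of_tendsto_of_tendsto_of_le_of_le tendsto_const_nhds hlim (fun _ => zero_le)
    fun n => ?_
  calc edist (w n) u = cutDist ν ν u (w n) := edist_comm _ _
    _ ≤ cutNorm ν ν (u.toFun - (v n).toFun) := cutDist_le_cutNorm (hΨ n) _ _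
    _ = cutNorm ν ν ((v n).toFun - u.toFun) := cutNorm_sub_comm _ _
    _ ≤ 2 * 2⁻¹ ^ n := hvu n

end Completeness

section Regularity

lemma norm_sub_inner_smul_sq_le {E : Type*} [NormedAddCommGroup E] [InnerProductSpace ℝ E]
    (x : E) {g : E} (hg : ‖g‖ ≤ 1) :
    ‖x - inner ℝ g x • g‖ ^ 2 ≤ ‖x‖ ^ 2 - inner ℝ g x ^ 2 := by
  have hg2 : ‖g‖ ^ 2 ≤ 1 := pow_le_one₀ (norm_nonneg g) hg
  rw [norm_sub_sq_real, real_inner_smul_right, norm_smul, Real.norm_eq_abs, mul_pow, sq_abs,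
    real_inner_comm g x]
  linarith [mul_le_of_le_one_right (sq_nonneg (inner ℝ g x)) hg2]

-- Energy decrement: subtracting from `x` its component along an element of `s` with which it
-- correlates lowers `‖x‖²` by more than `ε²`, so there are at most `k` such subtractions.
lemma exists_greedy_approx {E : Type*} [NormedAddCommGroup E] [InnerProductSpace ℝ E] {s : Set E}
    (hs : s.Nonempty) (hs1 : ∀ g ∈ s, ‖g‖ ≤ 1) {ε R : ℝ} (hε : 0 ≤ ε) {k : ℕ} {x : E}
    (hxR : ‖x‖ ≤ R) (hx : ‖x‖ ^ 2 ≤ k * ε ^ 2) :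
    ∃ (a : Fin k → ℝ) (f : Fin k → E), (∀ i, |a i| ≤ R) ∧ (∀ i, f i ∈ s) ∧
      ∀ g ∈ s, |inner ℝ g (x - ∑ i, a i • f i)| ≤ ε := by
  induction k generalizing x with
  | zero =>
    have hx0 : x = 0 := by simpa using hx
    exact ⟨Fin.elim0, Fin.elim0, fun i => i.elim0, fun i => i.elim0, fun g _ => by simpa [hx0]⟩
  | succ k ih =>
    by_cases huncorrelated : ∀ g ∈ s, |inner ℝ g x| ≤ ε
    · obtain ⟨g, hg⟩ := hs
      refine ⟨0, fun _ => g, fun i => ?_, fun _ => hg, by simpa using huncorrelated⟩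
      simpa using (norm_nonneg x).trans hxR
    push Not at huncorrelated
    obtain ⟨g, hg, hgε⟩ := huncorrelated
    have henergy := norm_sub_inner_smul_sq_le x (hs1 g hg)
    have hε2 : ε ^ 2 ≤ inner ℝ g x ^ 2 := by
      rw [← sq_abs (inner ℝ g x)]
      exact pow_le_pow_left₀ hε hgε.le 2
    have hle : ‖x - inner ℝ g x • g‖ ≤ ‖x‖ :=
      (sq_le_sq₀ (norm_nonneg _) (norm_nonneg _)).mp
        (henergy.trans (sub_le_self _ (sq_nonneg _)))
    push_cast at hx
    obtain ⟨a, f, ha, hf, hfg⟩ := ih (hle.trans hxR) (by linarith)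
    refine ⟨Fin.cons (inner ℝ g x) a, Fin.cons g f, Fin.cases ?_ ha, Fin.cases hg hf, ?_⟩
    · simpa only [Fin.sum_univ_succ, Fin.cons_zero, Fin.cons_succ, ← sub_sub] using hfg
    · calc |inner ℝ g x| ≤ ‖g‖ * ‖x‖ := abs_real_inner_le_norm g x
        _ ≤ 1 * ‖x‖ := by gcongr; exact hs1 g hg
        _ ≤ R := (one_mul _).trans_le hxR

variable {I J E : Type*} [MeasurableSpace I] [MeasurableSpace J] [NormedAddCommGroup E]
  {μ : Measure I} {ν : Measure J}

/-- The rectangles `1_{S × T} e` with `‖e‖ ≤ 1` as elements of `L²`. The cut norm of a kernel in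
`L²` is the supremum of its inner products with them. -/
def rectangles (E : Type*) [NormedAddCommGroup E] (μ : Measure I) (ν : Measure J)
    [IsFiniteMeasure μ] [IsFiniteMeasure ν] : Set (Lp E 2 (μ.prod ν)) :=
  {f | ∃ (S : Set I) (T : Set J) (hS : MeasurableSet S) (hT : MeasurableSet T) (e : E),
    ‖e‖ ≤ 1 ∧ f = indicatorConstLp 2 (hS.prod hT) (measure_ne_top _ _) e}

lemma norm_le_one_of_mem_rectangles [IsProbabilityMeasure μ] [IsProbabilityMeasure ν]
    {f : Lp E 2 (μ.prod ν)} (hf : f ∈ rectangles E μ ν) : ‖f‖ ≤ 1 := by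
  obtain ⟨S, T, hS, hT, e, he, rfl⟩ := hf
  exact norm_indicatorConstLp_le.trans (mul_le_one₀ he (by positivity)
    (Real.rpow_le_one measureReal_nonneg measureReal_le_one (by norm_num)))

variable [InnerProductSpace ℝ E]

lemma cutNorm_coeFn_le [IsFiniteMeasure μ] [IsFiniteMeasure ν] [CompleteSpace E]
    {f : Lp E 2 (μ.prod ν)} {ε : ℝ} (hf : ∀ g ∈ rectangles E μ ν, |inner ℝ g f| ≤ ε) :
    cutNorm μ ν f ≤ ENNReal.ofReal ε := by
  refine iSup₂_le fun e he => iSup₂_le fun S hS => iSup₂_le fun T hT =>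
    ENNReal.ofReal_le_ofReal ?_
  rw [← L2.inner_indicatorConstLp_eq_inner_setIntegral ℝ (hS.prod hT) (measure_ne_top _ _) e f]
  exact (le_abs_self _).trans (hf _ ⟨S, T, hS, hT, e, he, rfl⟩)

theorem exists_rectangle_approx (μ : Measure I) (ν : Measure J) [IsProbabilityMeasure μ]
    [IsProbabilityMeasure ν] (E : Type*) [NormedAddCommGroup E] [InnerProductSpace ℝ E]
    [CompleteSpace E] (R : ℝ) {ε : ℝ} (hε : 0 < ε) :
    ∃ n : ℕ, ∀ w : Lp E 2 (μ.prod ν), ‖w‖ ≤ R →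
      ∃ (S : Fin n → Set I) (T : Fin n → Set J) (b : Fin n → E), (∀ i, MeasurableSet (S i)) ∧
        (∀ i, MeasurableSet (T i)) ∧ (∀ i, ‖b i‖ ≤ R) ∧
        cutNorm μ ν (⇑w - fun p => ∑ i, (S i ×ˢ T i).indicator (fun _ => b i) p)
          ≤ ENNReal.ofReal ε := by
  obtain ⟨n, hn⟩ := exists_nat_ge (R ^ 2 / ε ^ 2)
  refine ⟨n, fun w hw => ?_⟩
  have henergy : ‖w‖ ^ 2 ≤ n * ε ^ 2 :=
    (pow_le_pow_left₀ (norm_nonneg w) hw 2).trans ((div_le_iff₀ (by positivity)).mp hn)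
  obtain ⟨a, f, ha, hf, hfg⟩ := exists_greedy_approx (s := rectangles E μ ν)
    ⟨_, ∅, ∅, .empty, .empty, 0, by simp, rfl⟩ (fun g => norm_le_one_of_mem_rectangles) hε.le
    hw henergy
  choose S T hS hT e he hfe using hf
  refine ⟨S, T, fun i => a i • e i, hS, hT, fun i => ?_, ?_⟩
  · rw [norm_smul]
    exact (mul_le_of_le_one_right (norm_nonneg _) (he i)).trans (ha i)
  refine (cutNorm_congr_ae ?_).trans_le (cutNorm_coeFn_le hfg)
  have hcoeFn : ∀ᵐ p ∂(μ.prod ν), ∀ i,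
      (a i • f i) p = (S i ×ˢ T i).indicator (fun _ => a i • e i) p := by
    refine ae_all_iff.mpr fun i => ?_
    rw [hfe i]
    filter_upwards [Lp.coeFn_smul (a i) (indicatorConstLp 2 ((hS i).prod (hT i))
      (measure_ne_top (μ.prod ν) _) (e i)), indicatorConstLp_coeFn (p := 2)
      (hs := (hS i).prod (hT i)) (hμs := measure_ne_top (μ.prod ν) _) (c := e i)] with p hsmul hind
    rw [hsmul, Pi.smul_apply, hind, Set.indicator_const_smul_apply]
  filter_upwards [Lp.coeFn_sub w (∑ i, a i • f i),
    Lp.coeFn_finsetSum Finset.univ fun i => a i • f i, hcoeFn] with p hsub hsum hp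
  simp only [hsub, Pi.sub_apply, hsum, Finset.sum_apply, hp]

end Regularity

section StepKernels

variable {I J E H : Type*} [NormedAddCommGroup E]

/-- The kernel that takes the value `v i j` on the cell `h⁻¹ i × h⁻¹ j` of the partition of `J × J`
induced by a map `h` to `M` labels. -/
def stepKernel {M : ℕ} (v : Fin M → Fin M → E) (h : J → Fin M) : J × J → E :=
  fun p => v (h p.1) (h p.2)

lemma norm_stepKernel_le {M : ℕ} (v : Fin M → Fin M → E) (h : J → Fin M) (p : J × J) :
    ‖stepKernel v h p‖ ≤ ‖v‖ :=
  (norm_le_pi_norm (v (h p.1)) (h p.2)).trans (norm_le_pi_norm v (h p.1))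

variable [MeasurableSpace I] [MeasurableSpace J] {μ : Measure I} {ν : Measure J}

lemma integrable_stepKernel [IsFiniteMeasure ν] {M : ℕ} (v : Fin M → Fin M → E) {h : J → Fin M}
    (hh : Measurable h) : Integrable (stepKernel v h) (ν.prod ν) :=
  have hv : StronglyMeasurable (Function.uncurry v) := .of_discrete
  .of_bound (hv.comp_measurable (hh.prodMap hh)).aestronglyMeasurable ‖v‖
    (.of_forall (norm_stepKernel_le v h))

-- Label a point by the set of rectangle sides that contain it.
lemma exists_isCompact_forall_eq_stepKernel [NormedSpace ℝ E] [ProperSpace E] (n : ℕ) (R : ℝ) :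
    ∃ (M : ℕ) (V : Set (Fin M → Fin M → E)), IsCompact V ∧
      ∀ (S T : Fin n → Set J) (b : Fin n → E), (∀ k, MeasurableSet (S k)) →
        (∀ k, MeasurableSet (T k)) → (∀ k, ‖b k‖ ≤ R) → ∃ v ∈ V, ∃ h : J → Fin M, Measurable h ∧
          (fun p => ∑ k, (S k ×ˢ T k).indicator (fun _ => b k) p) = stepKernel v h := by
  classical
  let q : (Fin n → Prop × Prop) ≃ Fin (Fintype.card (Fin n → Prop × Prop)) := Fintype.equivFin _
  let F (b : Fin n → E) (i j : Fin (Fintype.card (Fin n → Prop × Prop))) : E :=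
    ∑ k, if (q.symm i k).1 ∧ (q.symm j k).2 then b k else 0
  have hF : Continuous F := by
    refine continuous_pi fun i => continuous_pi fun j => continuous_finsetSum _ fun k _ => ?_
    exact continuous_if_const _ (fun _ => continuous_apply k) fun _ => continuous_const
  refine ⟨_, F '' Set.univ.pi fun _ => Metric.closedBall 0 R,
    (isCompact_univ_pi fun _ => isCompact_closedBall 0 R).image hF, fun S T b hS hT hb => ?_⟩
  let sides (x : J) (k : Fin n) : Prop × Prop := (x ∈ S k, x ∈ T k)
  have hsides : Measurable sides := measurable_pi_iff.mpr fun k =>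
    (measurableSet_setOfPred.mp (hS k)).prodMk (measurableSet_setOfPred.mp (hT k))
  have hq : Measurable q := .of_discrete
  refine ⟨F b, ⟨b, fun k _ => mem_closedBall_zero_iff.mpr (hb k), rfl⟩, q ∘ sides,
    hq.comp hsides, funext fun p => Finset.sum_congr rfl fun k _ => ?_⟩
  simp only [Function.comp_apply, Equiv.symm_apply_apply, sides, Set.indicator_apply,
    Set.mem_prod]

variable [NormedAddCommGroup H] [InnerProductSpace ℝ H]

lemma exists_finiteDimensional_norm_sub_starProjection_le {K : Set H} (hK : IsCompact K) {ε : ℝ}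
    (hε : 0 < ε) : ∃ (F : Submodule ℝ H) (_ : FiniteDimensional ℝ F),
      ∀ x ∈ K, ‖x - F.starProjection x‖ ≤ ε := by
  obtain ⟨t, -, ht, hKt⟩ := hK.finite_cover_balls hε
  have : FiniteDimensional ℝ (Submodule.span ℝ t) := .span_of_finite ℝ ht
  refine ⟨Submodule.span ℝ t, this, fun x hx => ?_⟩
  obtain ⟨y, hy, hxy⟩ := Set.mem_iUnion₂.mp (hKt hx)
  rw [Submodule.starProjection_minimal]
  refine (ciInf_le ⟨0, Set.forall_mem_range.mpr fun _ => norm_nonneg _⟩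
    (⟨y, Submodule.subset_span hy⟩ : Submodule.span ℝ t)).trans ?_
  rw [← dist_eq_norm]
  exact (Metric.mem_ball.mp hxy).le

lemma exists_stepKernel_approx [IsProbabilityMeasure ν] [CompleteSpace H]
    (K : TopologicalSpace.Compacts H) {ε : ℝ} (hε : 0 < ε) :
    ∃ (M : ℕ) (V : Set (Fin M → Fin M → H)), IsCompact V ∧ ∀ w : KernelsIn ν K,
      ∃ v ∈ V, ∃ h : J → Fin M, Measurable h ∧
        cutNorm ν ν (⇑w - stepKernel v h) ≤ ENNReal.ofReal ε := by
  obtain ⟨F, hF, hKF⟩ := exists_finiteDimensional_norm_sub_starProjection_le K.isCompact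
    (half_pos hε)
  obtain ⟨R, hR0, hR⟩ := K.isCompact.isBounded.exists_pos_norm_le
  obtain ⟨n, hn⟩ := exists_rectangle_approx ν ν F R (half_pos hε)
  obtain ⟨M, V, hV, hVn⟩ := exists_isCompact_forall_eq_stepKernel (J := J) (E := F) n R
  have hincl : Continuous fun (v : Fin M → Fin M → F) i j => (v i j : H) := by fun_prop
  refine ⟨M, _, hV.image hincl, fun w => ?_⟩
  let w' : J × J → F := F.orthogonalProjectionOnto ∘ w
  have hmem : MemLp w' 2 (ν.prod ν) := F.orthogonalProjectionOnto.comp_memLp' (w.memLp 2)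
  have hnorm : ‖hmem.toLp‖ ≤ R := by
    refine (Lp.norm_le_of_ae_bound hR0.le ?_).trans_eq (by simp [measureUnivNNReal])
    filter_upwards [hmem.coeFn_toLp, w.ae_mem] with p hp hpK
    rw [hp]
    exact (F.norm_orthogonalProjectionOnto_apply_le _).trans (hR _ hpK)
  obtain ⟨S, T, b, hS, hT, hb, hSTb⟩ := hn hmem.toLp hnorm
  obtain ⟨v, hv, h, hh, heq⟩ := hVn S T b hS hT hb
  refine ⟨_, ⟨v, hv, rfl⟩, h, hh, ?_⟩
  have hint : Integrable w' (ν.prod ν) := hmem.integrable one_le_two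
  have hproj : cutNorm ν ν (⇑w - F.subtypeL ∘ w') ≤ ENNReal.ofReal (ε / 2) :=
    cutNorm_le_of_ae_norm_le (w.ae_mem.mono fun p hp => hKF _ hp)
  have hstep : cutNorm ν ν (F.subtypeL ∘ (w' - stepKernel v h)) ≤ ENNReal.ofReal (ε / 2) := by
    refine (cutNorm_clm_comp_le _ (hint.sub (integrable_stepKernel v hh))).trans ?_
    refine (mul_le_of_le_one_left' ?_).trans ?_
    · rw [← ofReal_norm, ← ENNReal.ofReal_one]
      exact ENNReal.ofReal_le_ofReal F.norm_subtypeL_le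
    rw [← heq]
    exact (cutNorm_congr_ae (hmem.coeFn_toLp.symm.sub .rfl)).trans_le hSTb
  calc cutNorm ν ν (⇑w - stepKernel (fun i j => (v i j : H)) h)
      ≤ cutNorm ν ν (⇑w - F.subtypeL ∘ w') + cutNorm ν ν (F.subtypeL ∘ (w' - stepKernel v h)) :=
        cutNorm_sub_le w.integrable (F.subtypeL.integrable_comp hint)
          (integrable_stepKernel _ hh)
    _ ≤ ENNReal.ofReal (ε / 2) + ENNReal.ofReal (ε / 2) := add_le_add hproj hstep
    _ = ENNReal.ofReal ε := by rw [← ENNReal.ofReal_add (by positivity) (by positivity), add_halves]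

lemma cutNorm_stepKernel_sub_stepKernel_le [IsProbabilityMeasure ν] {M : ℕ}
    (v : Fin M → Fin M → H) {h h' : J → Fin M} (hh : Measurable h) (hh' : Measurable h') :
    cutNorm ν ν (stepKernel v h - stepKernel v h') ≤
      ENNReal.ofReal (4 * ‖v‖ * ν.real {x | h x ≠ h' x}) := by
  set D : Set J := {x | h x ≠ h' x}
  have hD : MeasurableSet D := (measurableSet_eq_fun hh hh').compl
  have hpt (p : J × J) : ‖(stepKernel v h - stepKernel v h') p‖ₑ ≤
      (D ×ˢ Set.univ).indicator (fun _ => ENNReal.ofReal (2 * ‖v‖)) p +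
        (Set.univ ×ˢ D).indicator (fun _ => ENNReal.ofReal (2 * ‖v‖)) p := by
    have hbound : ‖(stepKernel v h - stepKernel v h') p‖ₑ ≤ ENNReal.ofReal (2 * ‖v‖) := by
      rw [← ofReal_norm, two_mul]
      exact ENNReal.ofReal_le_ofReal <| (norm_sub_le _ _).trans <|
        add_le_add (norm_stepKernel_le v h p) (norm_stepKernel_le v h' p)
    by_cases h₁ : p.1 ∈ D
    · simpa [Set.indicator, h₁] using hbound.trans le_self_add
    by_cases h₂ : p.2 ∈ D
    · simpa [Set.indicator, h₁, h₂] using hbound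
    · simp [stepKernel, not_not.mp h₁, not_not.mp h₂]
  calc cutNorm ν ν (stepKernel v h - stepKernel v h')
      ≤ ∫⁻ p, ‖(stepKernel v h - stepKernel v h') p‖ₑ ∂(ν.prod ν) := cutNorm_le_lintegral _
    _ ≤ ENNReal.ofReal (2 * ‖v‖) * ν D + ENNReal.ofReal (2 * ‖v‖) * ν D := by
        refine (lintegral_mono hpt).trans_eq ?_
        rw [lintegral_add_left (measurable_const.indicator (hD.prod .univ)),
          lintegral_indicator_const (hD.prod .univ), lintegral_indicator_const (.prod .univ hD),
          Measure.prod_prod, Measure.prod_prod, measure_univ, mul_one, one_mul]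
    _ = ENNReal.ofReal (4 * ‖v‖ * ν.real D) := by
        rw [← add_mul, ← ENNReal.ofReal_add (by positivity) (by positivity),
          ENNReal.ofReal_mul (by positivity), ofReal_measureReal]
        ring_nf

lemma cutDist_stepKernel_le [StandardBorelSpace I] [StandardBorelSpace J] [IsProbabilityMeasure μ]
    [IsProbabilityMeasure ν] [NullSingletonClass μ] [NullSingletonClass ν] {M : ℕ}
    (v v' : Fin M → Fin M → H) {h : I → Fin M} {h' : J → Fin M} (hh : Measurable h)
    (hh' : Measurable h') :
    cutDist μ ν (stepKernel v h) (stepKernel v' h') ≤ ENNReal.ofReal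
      (4 * ‖v‖ * ∑ i, |μ.real {x | h x ≤ i} - ν.real {y | h' y ≤ i}| + ‖v - v'‖) := by
  obtain ⟨Φ, hΦ, hdiff⟩ := exists_rearrangement μ ν hh hh'
  have hh'Φ : Measurable (h' ∘ Φ) := hh'.comp Φ.measurable
  rw [ENNReal.ofReal_add (by positivity) (norm_nonneg _)]
  calc cutDist μ ν (stepKernel v h) (stepKernel v' h')
      ≤ cutNorm μ μ (stepKernel v h - stepKernel v' (h' ∘ Φ)) := cutDist_le_cutNorm hΦ _ _
    _ ≤ cutNorm μ μ (stepKernel v h - stepKernel v (h' ∘ Φ)) +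
        cutNorm μ μ (stepKernel (v - v') (h' ∘ Φ)) := cutNorm_sub_le (integrable_stepKernel v hh)
          (integrable_stepKernel v hh'Φ) (integrable_stepKernel v' hh'Φ)
    _ ≤ _ := by
        gcongr
        · refine (cutNorm_stepKernel_sub_stepKernel_le v hh hh'Φ).trans ?_
          gcongr
          exact hdiff
        · exact cutNorm_le_of_ae_norm_le (.of_forall (norm_stepKernel_le (v - v') (h' ∘ Φ)))

end StepKernels

section TotallyBounded

lemma exists_finite_cover_of_totallyBounded_range {α Z : Type*} [PseudoEMetricSpace α]
    [PseudoEMetricSpace Z] {f : α → Z} (hf : TotallyBounded (Set.range f)) {δ ε : ℝ≥0∞}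
    (hδ : 0 < δ) (h : ∀ x y, edist (f x) (f y) < δ → edist x y < ε) :
    ∃ t : Set α, t.Finite ∧ ∀ x, ∃ y ∈ t, edist x y < ε := by
  obtain ⟨s, hs, hsfin, hcover⟩ := EMetric.totallyBounded_iff'.mp hf δ hδ
  obtain ⟨t, -, ht, rfl⟩ :=
    Set.exists_subset_image_finite_and.mp ⟨s, hs.trans_eq Set.image_univ.symm, hsfin, rfl⟩
  refine ⟨t, ht, fun x => ?_⟩
  obtain ⟨z, hz, hxz⟩ := Set.mem_iUnion₂.mp (hcover ⟨x, rfl⟩)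
  obtain ⟨y, hy, rfl⟩ := hz
  exact ⟨y, hy, h x y hxz⟩

variable {J H : Type*} [MeasurableSpace J] [StandardBorelSpace J] [NormedAddCommGroup H]
  [InnerProductSpace ℝ H] [CompleteSpace H] {ν : Measure J} [IsProbabilityMeasure ν]
  [NullSingletonClass ν] {K : TopologicalSpace.Compacts H}

lemma exists_finite_cover_kernelsIn {ε : ℝ} (hε : 0 < ε) :
    ∃ t : Set (KernelsIn ν K), t.Finite ∧ ∀ w, ∃ w' ∈ t, edist w w' < ENNReal.ofReal ε := by
  obtain ⟨M, V, hV, hVK⟩ := exists_stepKernel_approx (ν := ν) K (ε := ε / 4) (by positivity)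
  choose v hv h hh hvh using hVK
  obtain ⟨C, hC0, hC⟩ := hV.isBounded.exists_pos_norm_le
  set δ : ℝ := ε / 4 / (4 * C * M + 1) with hδ
  have hδ0 : 0 < δ := by positivity
  let mass (w : KernelsIn ν K) (i : Fin M) : ℝ := ν.real {x | h w x ≤ i}
  have hmass (w) : mass w ∈ Set.univ.pi fun _ => Set.Icc (0 : ℝ) 1 :=
    Set.mem_univ_pi.mpr fun _ => ⟨measureReal_nonneg, measureReal_le_one⟩
  have htb : TotallyBounded (Set.range fun w => (v w, mass w)) :=
    (hV.prod (isCompact_univ_pi fun _ => isCompact_Icc)).totallyBounded.subset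
      (Set.range_subset_iff.mpr fun w => Set.mk_mem_prod (hv w) (hmass w))
  refine exists_finite_cover_of_totallyBounded_range htb (ENNReal.ofReal_pos.mpr hδ0)
    fun w w' hww' => ?_
  rw [edist_lt_ofReal, Prod.dist_eq, max_lt_iff] at hww'
  have hstep : cutDist ν ν (stepKernel (v w) (h w)) (stepKernel (v w') (h w')) ≤
      ENNReal.ofReal (ε / 4) := by
    refine (cutDist_stepKernel_le _ _ (hh w) (hh w')).trans (ENNReal.ofReal_le_ofReal ?_)
    have hsum : ∑ i, |mass w i - mass w' i| ≤ M * δ := by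
      refine (Finset.sum_le_card_nsmul _ _ δ fun i _ => ?_).trans_eq (by simp)
      exact (dist_le_pi_dist (mass w) (mass w') i).trans hww'.2.le
    calc 4 * ‖v w‖ * ∑ i, |mass w i - mass w' i| + ‖v w - v w'‖
        ≤ 4 * C * (M * δ) + δ := by
          gcongr
          · exact hC _ (hv w)
          · exact (dist_eq_norm _ _).symm.trans_le hww'.1.le
      _ = ε / 4 := by rw [hδ]; field_simp
  have hint (w) : Integrable (stepKernel (v w) (h w)) (ν.prod ν) := integrable_stepKernel _ (hh w)
  calc cutDist ν ν w w'
      ≤ cutDist ν ν w (stepKernel (v w) (h w)) +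
        (cutDist ν ν (stepKernel (v w) (h w)) (stepKernel (v w') (h w')) +
          cutDist ν ν (stepKernel (v w') (h w')) w') :=
        (cutDist_triangle w.integrable (hint w) w'.integrable).trans <|
          add_le_add_right (cutDist_triangle (hint w) (hint w') w'.integrable) _
    _ ≤ ENNReal.ofReal (ε / 4) + (ENNReal.ofReal (ε / 4) + ENNReal.ofReal (ε / 4)) :=
        add_le_add ((cutDist_le_cutNorm_sub _ _).trans (hvh w)) <| add_le_add hstep <|
          (cutDist_le_cutNorm_sub _ _).trans ((cutNorm_sub_comm _ _).trans_le (hvh w'))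
    _ = ENNReal.ofReal (3 * (ε / 4)) := by
        rw [← ENNReal.ofReal_add, ← ENNReal.ofReal_add] <;> first | positivity | ring_nf
    _ < ENNReal.ofReal ε := (ENNReal.ofReal_lt_ofReal_iff hε).mpr (by linarith)

theorem totallyBounded_kernelsIn : TotallyBounded (Set.univ : Set (KernelsIn ν K)) := by
  refine EMetric.totallyBounded_iff.mpr fun ε hε => ?_
  obtain ⟨r, hr, hrε⟩ := ENNReal.lt_iff_exists_nnreal_btwn.mp hε
  obtain ⟨t, ht, hcover⟩ := exists_finite_cover_kernelsIn (ν := ν) (K := K)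
    (ε := r) (by exact_mod_cast hr)
  refine ⟨t, ht, fun w _ => ?_⟩
  obtain ⟨w', hw', hlt⟩ := hcover w
  rw [ENNReal.ofReal_coe_nnreal] at hlt
  exact Set.mem_iUnion₂.mpr ⟨w', hw', hlt.trans hrε⟩

theorem compactSpace_kernelsIn (hconv : Convex ℝ (K : Set H)) : CompactSpace (KernelsIn ν K) :=
  have := completeSpace_kernelsIn (ν := ν) hconv
  ⟨isCompact_iff_totallyBounded_isComplete.mpr
    ⟨totallyBounded_kernelsIn, isClosed_univ.isComplete⟩⟩

end TotallyBounded

section SequentialCompactness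

lemma exists_measurePreserving_equiv {I J : Type*} [MeasurableSpace I] [StandardBorelSpace I]
    [MeasurableSpace J] [StandardBorelSpace J] (μ : Measure I) [IsProbabilityMeasure μ]
    [NullSingletonClass μ] (ν : Measure J) [IsProbabilityMeasure ν] [NullSingletonClass ν] :
    ∃ θ : I ≃ᵐ J, MeasurePreserving θ μ ν := by
  obtain ⟨θ, hθ, -⟩ := exists_measurableEquiv_unitInterval_ae_eq_cdf μ
    (measurableEmbedding_embeddingReal I).measurable (measurableEmbedding_embeddingReal I).injective
  obtain ⟨η, hη, -⟩ := exists_measurableEquiv_unitInterval_ae_eq_cdf ν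
    (measurableEmbedding_embeddingReal J).measurable (measurableEmbedding_embeddingReal J).injective
  exact ⟨θ.trans η.symm, hη.symm.comp hθ⟩

lemma cutDist_comp_symm {I J H : Type*} [MeasurableSpace I] [MeasurableSpace J]
    [NormedAddCommGroup H] [InnerProductSpace ℝ H] {μ : Measure I} {ν : Measure J} {θ : I ≃ᵐ J}
    (hθ : MeasurePreserving θ μ ν) (w : I × I → H) :
    cutDist μ ν w (w ∘ Prod.map θ.symm θ.symm) = 0 := by
  have hcancel : (w ∘ Prod.map θ.symm θ.symm) ∘ Prod.map θ θ = w := by ext p; simp [Prod.map]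
  refine nonpos_iff_eq_zero.mp ((cutDist_le_cutNorm hθ _ _).trans_eq ?_)
  rw [hcancel, sub_self, cutNorm_zero]

theorem exists_subseq_tendsto_cutDist {I : ℕ → Type*} [∀ n, MeasurableSpace (I n)]
    [∀ n, StandardBorelSpace (I n)] (μ : ∀ n, Measure (I n)) [∀ n, IsProbabilityMeasure (μ n)]
    [∀ n, NullSingletonClass (μ n)] {J : Type*} [MeasurableSpace J] [StandardBorelSpace J]
    (ν : Measure J) [IsProbabilityMeasure ν] [NullSingletonClass ν] {H : Type*}
    [NormedAddCommGroup H] [InnerProductSpace ℝ H] [CompleteSpace H]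
    {K : TopologicalSpace.Compacts H} (hconv : Convex ℝ (K : Set H))
    (w : ∀ n, KernelsIn (μ n) K) :
    ∃ φ : ℕ → ℕ, StrictMono φ ∧ ∃ u : KernelsIn ν K,
      Tendsto (fun k => cutDist (μ (φ k)) ν (w (φ k)) u) atTop (𝓝 0) := by
  choose θ hθ using fun n => exists_measurePreserving_equiv (μ n) ν
  let v (n : ℕ) : KernelsIn ν K := (w n).comap (hθ n).symm
  have := compactSpace_kernelsIn (ν := ν) hconv
  obtain ⟨u, φ, hφ, hu⟩ := CompactSpace.tendsto_subseq v
  refine ⟨φ, hφ, u, tendsto_of_tendsto_of_tendsto_of_le_of_le tendsto_const_nhds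
    (tendsto_iff_edist_tendsto_0.mp hu) (fun _ => zero_le) fun k => ?_⟩
  calc cutDist (μ (φ k)) ν (w (φ k)) u
      ≤ cutDist (μ (φ k)) ν (w (φ k)) (v (φ k)) + cutDist ν ν (v (φ k)) u :=
        cutDist_triangle (w (φ k)).integrable (v (φ k)).integrable u.integrable
    _ = edist (v (φ k)) u :=
        (congrArg (· + _) (cutDist_comp_symm (hθ (φ k)) (w (φ k)))).trans (zero_add _)

end SequentialCompactness

section BanachValued

open scoped Pointwise

variable {Ω B H : Type*} [MeasurableSpace Ω] {P : Measure Ω} [NormedAddCommGroup B]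
  [NormedSpace ℝ B] [NormedAddCommGroup H] [NormedSpace ℝ H] {ι : B →L[ℝ] H}

lemma isClosed_image_closedBall (hclosed : IsClosed (ι '' Metric.closedBall (0 : B) 1)) {R : ℝ}
    (hR : 0 < R) : IsClosed (ι '' Metric.closedBall (0 : B) R) := by
  have hball : ι '' Metric.closedBall (0 : B) R = R • (ι '' Metric.closedBall (0 : B) 1) := by
    rw [← image_smul_set, smul_closedBall _ _ zero_le_one, smul_zero, mul_one,
      Real.norm_of_nonneg hR.le]
  rw [hball]
  exact hclosed.smul_of_ne_zero hR.ne'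

lemma exists_memLInfty_lift (hclosed : IsClosed (ι '' Metric.closedBall (0 : B) 1)) {u : Ω → H}
    {r : ℝ} (hu : AEStronglyMeasurable u P)
    (hur : ∀ᵐ p ∂P, u p ∈ closure (ι '' Metric.closedBall (0 : B) r)) :
    ∃ w : Ω → B, MemLInfty ι P w ∧ u =ᵐ[P] fun p => ι (w p) := by
  have hpreimage : ∀ x ∈ closure (ι '' Metric.closedBall (0 : B) r),
      ∃ b ∈ Metric.closedBall (0 : B) (max r 1), ι b = x :=
    closure_minimal (Set.image_mono (Metric.closedBall_subset_closedBall (le_max_left r 1)))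
      (isClosed_image_closedBall hclosed (lt_max_of_lt_right one_pos))
  choose! g hg hgι using hpreimage
  have hug : u =ᵐ[P] fun p => ι (g (u p)) := hur.mono fun p hp => (hgι _ hp).symm
  exact ⟨g ∘ u, ⟨hu.congr hug, max r 1, hur.mono fun p hp =>
    mem_closedBall_zero_iff.mp (hg _ hp)⟩, hug⟩

end BanachValued

section Dirac

lemma continuous_lp_of_dominated {T ι : Type*} [TopologicalSpace T] {E : ι → Type*}
    [∀ i, NormedAddCommGroup (E i)] {q : ℝ≥0∞} [Fact (1 ≤ q)] (hq : q ≠ ⊤) {f : T → lp E q}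
    (hf : ∀ i, Continuous fun x => f x i) {b : lp E q} (hb : ∀ x i, ‖f x i‖ ≤ ‖b i‖) :
    Continuous f := by
  have hq0 : 0 < q.toReal := ENNReal.toReal_pos (one_pos.trans_le Fact.out).ne' hq
  refine continuous_iff_continuousAt.mpr fun x => tendsto_iff_norm_sub_tendsto_zero.mpr ?_
  have hsum : Tendsto (fun y => ∑' i, ‖(f y - f x) i‖ ^ q.toReal) (𝓝 x) (𝓝 (∑' _ : ι, (0 : ℝ))) :=
    tendsto_tsum_of_dominated_convergence
      (((lp.memℓp b).summable hq0).mul_left ((2 : ℝ) ^ q.toReal))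
      (fun i => by
        have hcont : Continuous fun y => ‖(f y - f x) i‖ ^ q.toReal :=
          ((hf i).sub continuous_const).norm.rpow_const fun _ => Or.inr hq0.le
        simpa [hq0.ne'] using hcont.tendsto x)
      (Eventually.of_forall fun y i => by
        rw [Real.norm_of_nonneg (by positivity), ← Real.mul_rpow (by norm_num) (norm_nonneg _)]
        refine Real.rpow_le_rpow (norm_nonneg _) ((norm_sub_le _ _).trans ?_) hq0.le
        linarith [hb y i, hb x i])
  rw [tsum_zero] at hsum
  have hroot := hsum.rpow_const (p := 1 / q.toReal) (Or.inr (by positivity))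
  rw [Real.zero_rpow (by positivity)] at hroot
  exact hroot.congr fun y => (lp.norm_eq_tsum_rpow hq0 _).symm

/-- The point mass at `x`, as an element of `H^{-1}`. -/
def diracHNegOne (x : UnitAddCircle) : HNegOne := measureToHNegOne (Measure.dirac x)

lemma diracHNegOne_apply (x : UnitAddCircle) (m : ℤ) : diracHNegOne x m =
    ((√(1 + 4 * Real.pi ^ 2 * (m : ℝ) ^ 2))⁻¹ : ℝ) • (fourier (-m) x : ℂ) := by
  change weightedCoeff (Measure.dirac x) m = _
  rw [weightedCoeff, fourierCoeffMeasure, integral_dirac]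

lemma continuous_diracHNegOne_apply (m : ℤ) : Continuous fun x => diracHNegOne x m := by
  simp_rw [diracHNegOne_apply]
  exact (fourier (-m)).continuous.const_smul (√(1 + 4 * Real.pi ^ 2 * (m : ℝ) ^ 2))⁻¹

lemma continuous_diracHNegOne : Continuous diracHNegOne :=
  continuous_lp_of_dominated (by simp) continuous_diracHNegOne_apply (b := diracHNegOne 0)
    fun x m => by simp [diracHNegOne_apply, fourier_apply, Circle.norm_coe]

lemma injective_diracHNegOne_one : Function.Injective fun x => diracHNegOne x 1 := by
  intro x y hxy
  simp only [diracHNegOne_apply] at hxy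
  have hfourier : fourier (-1) x = fourier (-1) y :=
    smul_right_injective ℂ (by positivity) hxy
  rw [fourier_apply, fourier_apply] at hfourier
  simpa using AddCircle.injective_toCircle one_ne_zero (Circle.ext hfourier)

-- A point of the circle depends continuously on the first Fourier coefficient of its point mass.
lemma isClosedEmbedding_diracHNegOne_one : IsClosedEmbedding fun x => diracHNegOne x 1 :=
  (continuous_diracHNegOne_apply 1).isClosedEmbedding injective_diracHNegOne_one

lemma exists_norm_diracHNegOne_le : ∃ R : ℝ, ∀ x, ‖diracHNegOne x‖ ≤ R :=
  let ⟨R, hR⟩ := (isCompact_range continuous_diracHNegOne).isBounded.exists_norm_le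
  ⟨R, fun x => hR _ ⟨x, rfl⟩⟩

end Dirac

section Marginal

variable {Ω I J : Type*} [MeasurableSpace Ω] [MeasurableSpace I] [MeasurableSpace J]

lemma lintegral_enorm_le_of_forall_setIntegral {P : Measure Ω} {g : Ω → ℝ}
    (hg : Integrable g P) {c : ℝ≥0∞} (h : ∀ T, MeasurableSet T → ‖∫ x in T, g x ∂P‖ₑ ≤ c) :
    ∫⁻ x, ‖g x‖ₑ ∂P ≤ 2 * c := by
  obtain ⟨f, hf, hgf⟩ := hg.aestronglyMeasurable
  have hfi : Integrable f P := hg.congr hgf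
  have hfc (T : Set Ω) (hT : MeasurableSet T) : ‖∫ x in T, f x ∂P‖ₑ ≤ c := by
    rw [← integral_congr_ae (ae_restrict_of_ae hgf)]
    exact h T hT
  rw [lintegral_congr_ae (hgf.mono fun x hx => congrArg _ hx),
    ← ofReal_integral_norm_eq_lintegral_enorm hfi, integral_norm_eq_pos_sub_neg hfi]
  calc ENNReal.ofReal ((∫ x in {x | 0 ≤ f x}, f x ∂P) - ∫ x in {x | f x ≤ 0}, f x ∂P)
      ≤ ‖(∫ x in {x | 0 ≤ f x}, f x ∂P) - ∫ x in {x | f x ≤ 0}, f x ∂P‖ₑ :=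
        Real.ofReal_le_enorm _
    _ ≤ ‖∫ x in {x | 0 ≤ f x}, f x ∂P‖ₑ + ‖∫ x in {x | f x ≤ 0}, f x ∂P‖ₑ := enorm_sub_le
    _ ≤ c + c := add_le_add (hfc _ (stronglyMeasurable_const.measurableSet_le hf))
        (hfc _ (hf.measurableSet_le stronglyMeasurable_const))
    _ = 2 * c := (two_mul c).symm

lemma lintegral_enorm_le_of_forall_setIntegral_complex {P : Measure Ω} {g : Ω → ℂ}
    (hg : Integrable g P) {c : ℝ≥0∞} (h : ∀ T, MeasurableSet T → ‖∫ x in T, g x ∂P‖ₑ ≤ c) :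
    ∫⁻ x, ‖g x‖ₑ ∂P ≤ 4 * c := by
  have hpart (L : ℂ →L[ℝ] ℝ) (hL : ∀ z, ‖L z‖ ≤ ‖z‖) : ∫⁻ x, ‖L (g x)‖ₑ ∂P ≤ 2 * c := by
    refine lintegral_enorm_le_of_forall_setIntegral (L.integrable_comp hg) fun T hT => ?_
    rw [L.integral_comp_comm hg.integrableOn]
    exact (enorm_le_iff_norm_le.mpr (hL _)).trans (h T hT)
  have hre_im (z : ℂ) : ‖z‖ₑ ≤ ‖Complex.reCLM z‖ₑ + ‖Complex.imCLM z‖ₑ := by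
    simp only [← ofReal_norm]
    rw [← ENNReal.ofReal_add (norm_nonneg _) (norm_nonneg _)]
    exact ENNReal.ofReal_le_ofReal (Complex.norm_le_abs_re_add_abs_im z)
  calc ∫⁻ x, ‖g x‖ₑ ∂P ≤ ∫⁻ x, (‖Complex.reCLM (g x)‖ₑ + ‖Complex.imCLM (g x)‖ₑ) ∂P :=
        lintegral_mono fun x => hre_im (g x)
    _ = ∫⁻ x, ‖Complex.reCLM (g x)‖ₑ ∂P + ∫⁻ x, ‖Complex.imCLM (g x)‖ₑ ∂P :=
        lintegral_add_left' (Complex.reCLM.integrable_comp hg).aestronglyMeasurable.enorm _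
    _ ≤ 2 * c + 2 * c :=
        add_le_add (hpart _ Complex.abs_re_le_norm) (hpart _ Complex.abs_im_le_norm)
    _ = 4 * c := by rw [← add_mul]; norm_num

lemma lintegral_enorm_integral_le_cutNorm {μ : Measure I} {ν : Measure J} [SFinite μ] [SFinite ν]
    {f : I × J → ℂ} (hf : Integrable f (μ.prod ν)) :
    ∫⁻ ζ, ‖∫ ξ, f (ξ, ζ) ∂μ‖ₑ ∂ν ≤ 4 * cutNorm μ ν f := by
  refine lintegral_enorm_le_of_forall_setIntegral_complex hf.integral_prod_right fun T hT => ?_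
  have hrestrict : (μ.prod ν).restrict (Set.univ ×ˢ T) = μ.prod (ν.restrict T) := by
    rw [← Measure.prod_restrict, Measure.restrict_univ]
  have hfubini : ∫ ζ in T, ∫ ξ, f (ξ, ζ) ∂μ ∂ν = ∫ p in Set.univ ×ˢ T, f p ∂(μ.prod ν) := by
    rw [hrestrict, integral_prod_symm f (hrestrict ▸ hf.integrableOn)]
  rw [hfubini]
  exact enorm_setIntegral_le_cutNorm f .univ hT

lemma exists_subseq_tendsto_ae_of_tendsto_cutNorm {μ : Measure I} [IsProbabilityMeasure μ]
    {ν : Measure J} [IsFiniteMeasure ν] {z : ℕ → J → ℂ} (hz : ∀ j, Integrable (z j) ν)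
    {f : I × J → ℂ} (hf : Integrable f (μ.prod ν))
    (h : Tendsto (fun j => cutNorm μ ν (z j ∘ Prod.snd - f)) atTop (𝓝 0)) :
    ∃ ψ : ℕ → ℕ, StrictMono ψ ∧ ∀ᵐ ζ ∂ν,
      Tendsto (fun j => z (ψ j) ζ) atTop (𝓝 (∫ ξ, f (ξ, ζ) ∂μ)) := by
  have hle (j : ℕ) : eLpNorm (z j - fun ζ => ∫ ξ, f (ξ, ζ) ∂μ) 1 ν ≤
      4 * cutNorm μ ν (z j ∘ Prod.snd - f) := by
    rw [eLpNorm_one_eq_lintegral_enorm]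
    refine (lintegral_congr_ae ?_).trans_le
      (lintegral_enorm_integral_le_cutNorm (((hz j).comp_snd μ).sub hf))
    filter_upwards [hf.prod_left_ae] with ζ hζ
    simp [integral_sub (integrable_const _) hζ]
  have hlim : Tendsto (fun j => 4 * cutNorm μ ν (z j ∘ Prod.snd - f)) atTop (𝓝 0) := by
    simpa using ENNReal.Tendsto.const_mul (a := 4) h (Or.inr (by simp))
  exact (tendstoInMeasure_of_tendsto_eLpNorm one_ne_zero
    (fun j => (hz j).aestronglyMeasurable) hf.integral_prod_right.aestronglyMeasurable
    (tendsto_of_tendsto_of_tendsto_of_le_of_le tendsto_const_nhds hlim (fun _ => zero_le)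
      hle)).exists_seq_tendsto_ae

end Marginal

section PairKernels

/-- The value `(δ_x, c δ_x)` taken by the kernel of a pair. -/
def pairValue (z : UnitAddCircle × ℝ) : PiLp 2 (fun _ : Fin 2 => HNegOne) :=
  WithLp.toLp 2 ![diracHNegOne z.1, z.2 • diracHNegOne z.1]

/-- The interval `[-C, C]` of admissible weights. -/
def weightInterval (C : ℝ) : TopologicalSpace.Compacts ℝ := ⟨Set.Icc (-C) C, isCompact_Icc⟩

lemma pairKernel_eq_pairValue {J : Type*} (w : J × J → ℝ) (X : J → UnitAddCircle) :
    pairKernel w X = fun p => pairValue (X p.2, w p) := rfl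

lemma continuous_pairValue : Continuous pairValue := by
  refine (PiLp.continuous_toLp 2 _).comp (continuous_pi fun i => ?_)
  have hdirac := continuous_diracHNegOne.comp (continuous_fst (X := UnitAddCircle) (Y := ℝ))
  fin_cases i
  · exact hdirac
  · exact continuous_snd.smul hdirac

lemma pairValue_eq_add_smul (x : UnitAddCircle) (c : ℝ) :
    pairValue (x, c) = pairValue (x, 0) + c • (pairValue (x, 1) - pairValue (x, 0)) := by
  ext i : 1
  fin_cases i <;> simp [pairValue]

lemma norm_pairValue_sub_le (x y : UnitAddCircle) (c : ℝ) :
    ‖pairValue (x, c) - pairValue (y, c)‖ ≤ (1 + |c|) * ‖diracHNegOne x - diracHNegOne y‖ := by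
  rw [PiLp.norm_eq_of_L2, Fin.sum_univ_two]
  refine Real.sqrt_le_iff.mpr ⟨by positivity, ?_⟩
  simp only [pairValue, PiLp.sub_apply, Matrix.cons_val_zero, Matrix.cons_val_one, ← smul_sub,
    norm_smul, Real.norm_eq_abs]
  nlinarith [mul_nonneg (abs_nonneg c) (sq_nonneg ‖diracHNegOne x - diracHNegOne y‖)]

/-- A compact convex set containing all values of the kernels of pairs with weights in
`[-C, C]`. -/
def pairHull (C : ℝ) : TopologicalSpace.Compacts (PiLp 2 (fun _ : Fin 2 => HNegOne)) where
  carrier := closure (convexHull ℝ (pairValue '' (Set.univ ×ˢ weightInterval C)))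
  isCompact' := ((isCompact_univ.prod (weightInterval C).isCompact).image
    continuous_pairValue).totallyBounded.convexHull.closure.isCompact_of_isClosed isClosed_closure

lemma pairValue_mem_pairHull (x : UnitAddCircle) {c C : ℝ} (hc : c ∈ weightInterval C) :
    pairValue (x, c) ∈ pairHull C :=
  subset_closure (subset_convexHull ℝ _ ⟨(x, c), ⟨trivial, hc⟩, rfl⟩)

lemma convex_pairHull (C : ℝ) :
    Convex ℝ (pairHull C : Set (PiLp 2 (fun _ : Fin 2 => HNegOne))) :=
  (convex_convexHull ℝ _).closure

variable {J : Type*} [MeasurableSpace J] {ν : Measure J} {C : ℝ}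

/-- The kernel of a pair with weights in `[-C, C]`, as a kernel with values in `pairHull C`. -/
def KernelsIn.pair (w : KernelsIn ν (weightInterval C)) {X : J → UnitAddCircle}
    (hX : Measurable X) : KernelsIn ν (pairHull C) where
  toFun := pairKernel w X
  aestronglyMeasurable := by
    rw [pairKernel_eq_pairValue]
    exact continuous_pairValue.comp_aestronglyMeasurable
      ((hX.comp measurable_snd).aestronglyMeasurable.prodMk w.aestronglyMeasurable)
  ae_mem := by
    rw [pairKernel_eq_pairValue]
    filter_upwards [w.ae_mem] with p hp using pairValue_mem_pairHull (X p.2) hp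

variable {X : ℕ → J → UnitAddCircle}

lemma exists_ae_tendsto_of_diracHNegOne_one (hX : ∀ j, Measurable (X j)) {y : J → ℂ}
    (h : ∀ᵐ ζ ∂ν, Tendsto (fun j => diracHNegOne (X j ζ) 1) atTop (𝓝 (y ζ))) :
    ∃ Y : J → UnitAddCircle, Measurable Y ∧
      ∀ᵐ ζ ∂ν, Tendsto (fun j => X j ζ) atTop (𝓝 (Y ζ)) := by
  refine measurable_limit_of_tendsto_metrizable_ae (fun j => (hX j).aemeasurable) ?_
  filter_upwards [h] with ζ hζ
  obtain ⟨x, hx⟩ := isClosedEmbedding_diracHNegOne_one.isClosed_range.mem_of_tendsto hζ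
    (Eventually.of_forall fun j => ⟨X j ζ, rfl⟩)
  rw [← hx] at hζ
  exact ⟨x, isClosedEmbedding_diracHNegOne_one.tendsto_nhds_iff.mpr hζ⟩

variable [IsProbabilityMeasure ν]

lemma exists_subseq_tendsto_position (w : ℕ → KernelsIn ν (weightInterval C))
    (hX : ∀ j, Measurable (X j)) {u : J × J → PiLp 2 (fun _ : Fin 2 => HNegOne)}
    (hu : Integrable u (ν.prod ν))
    (h : Tendsto (fun j => cutNorm ν ν (pairKernel (w j) (X j) - u)) atTop (𝓝 0)) :
    ∃ ψ : ℕ → ℕ, StrictMono ψ ∧ ∃ Y : J → UnitAddCircle, Measurable Y ∧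
      ∀ᵐ ζ ∂ν, Tendsto (fun j => X (ψ j) ζ) atTop (𝓝 (Y ζ)) := by
  -- `L (δ_x, c δ_x)` is the first weighted Fourier coefficient of `δ_x`.
  let L : PiLp 2 (fun _ : Fin 2 => HNegOne) →L[ℝ] ℂ :=
    (lp.evalCLM ℝ (fun _ : ℤ => ℂ) 2 1).comp (PiLp.proj 2 (fun _ : Fin 2 => HNegOne) 0)
  let z (j : ℕ) (ζ : J) : ℂ := diracHNegOne (X j ζ) 1
  obtain ⟨R, hR⟩ := exists_norm_diracHNegOne_le
  have hz (j : ℕ) : Integrable (z j) ν :=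
    .of_bound ((continuous_diracHNegOne_apply 1).measurable.comp (hX j)).aestronglyMeasurable R
      (Eventually.of_forall fun ζ => (lp.norm_apply_le_norm (by norm_num) _ _).trans (hR _))
  have hle (j : ℕ) : cutNorm ν ν (z j ∘ Prod.snd - L ∘ u) ≤
      ‖L‖ₑ * cutNorm ν ν (pairKernel (w j) (X j) - u) := by
    refine le_trans (le_of_eq (congrArg (cutNorm ν ν) (funext fun p => ?_)))
      (cutNorm_clm_comp_le L ((((w j).pair (hX j)).integrable).sub hu))
    exact (L.map_sub (pairKernel (w j) (X j) p) (u p)).symm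
  have hlim : Tendsto (fun j => ‖L‖ₑ * cutNorm ν ν (pairKernel (w j) (X j) - u)) atTop (𝓝 0) := by
    simpa using ENNReal.Tendsto.const_mul (a := ‖L‖ₑ) h (Or.inr enorm_ne_top)
  obtain ⟨ψ, hψ, hψz⟩ := exists_subseq_tendsto_ae_of_tendsto_cutNorm hz (L.integrable_comp hu)
    (tendsto_of_tendsto_of_tendsto_of_le_of_le tendsto_const_nhds hlim (fun _ => zero_le) hle)
  exact ⟨ψ, hψ, exists_ae_tendsto_of_diracHNegOne_one (fun j => hX (ψ j)) hψz⟩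

lemma tendsto_cutNorm_pairKernel_sub (w : ℕ → KernelsIn ν (weightInterval C))
    (hX : ∀ j, Measurable (X j)) {Y : J → UnitAddCircle}
    (hXY : ∀ᵐ ζ ∂ν, Tendsto (fun j => X j ζ) atTop (𝓝 (Y ζ))) :
    Tendsto (fun j => cutNorm ν ν (pairKernel (w j) (X j) - pairKernel (w j) Y)) atTop (𝓝 0) := by
  obtain ⟨R, hR⟩ := exists_norm_diracHNegOne_le
  have hdirac (j : ℕ) :
      AEStronglyMeasurable (fun p : J × J => diracHNegOne (X j p.2)) (ν.prod ν) :=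
    continuous_diracHNegOne.comp_aestronglyMeasurable
      ((hX j).comp measurable_snd).aestronglyMeasurable
  have hlim : Tendsto (fun j => ENNReal.ofReal (1 + C) *
      ∫⁻ p, ENNReal.ofReal ‖diracHNegOne (X j p.2) - diracHNegOne (Y p.2)‖ ∂(ν.prod ν))
      atTop (𝓝 0) := by
    have hL1 := tendsto_lintegral_norm_of_dominated_convergence (bound := fun _ => R)
      hdirac (hasFiniteIntegral_const R)
      (fun j => Eventually.of_forall fun p => hR (X j p.2))
      (Measure.quasiMeasurePreserving_snd.ae (hXY.mono fun ζ hζ =>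
        (continuous_diracHNegOne.tendsto (Y ζ)).comp hζ))
    simpa only [mul_zero] using ENNReal.Tendsto.const_mul hL1 (Or.inr ENNReal.ofReal_ne_top)
  refine tendsto_of_tendsto_of_tendsto_of_le_of_le tendsto_const_nhds hlim (fun _ => zero_le)
    fun j => (cutNorm_le_lintegral _).trans ?_
  rw [← lintegral_const_mul' _ _ ENNReal.ofReal_ne_top]
  refine lintegral_mono_ae ?_
  filter_upwards [(w j).ae_mem] with p hp
  have hwC : |w j p| ≤ C := abs_le.mpr hp
  rw [← ofReal_norm, ← ENNReal.ofReal_mul (by linarith [abs_nonneg (w j p)])]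
  refine ENNReal.ofReal_le_ofReal ((norm_pairValue_sub_le _ _ (w j p)).trans ?_)
  gcongr

end PairKernels

section PairLimits

variable {Ω ι H : Type*} [MeasurableSpace Ω] {P : Measure Ω} [NormedAddCommGroup H]
  [InnerProductSpace ℝ H]

lemma memLp_inner {p q r : ℝ≥0∞} [ENNReal.HolderTriple p q r] {f g : Ω → H} (hf : MemLp f p P)
    (hg : MemLp g q P) : MemLp (fun x => (inner ℝ (f x) (g x) : ℝ)) r P := by
  refine .of_bilin (fun x y => inner ℝ x y) 1 hf hg (hf.1.inner hg.1)
    (Eventually.of_forall fun x => ?_)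
  rw [one_mul]
  exact norm_inner_le_norm (𝕜 := ℝ) (f x) (g x)

lemma TendstoWeakL2.const_add_smul {w : ι → Ω → ℝ} {l : Filter ι} {u : Ω → ℝ}
    (h : TendstoWeakL2 P w l u) (hw : ∀ i, MemLp (w i) 2 P) (hu : MemLp u 2 P) {a b : Ω → H}
    (ha : MemLp a 2 P) (hb : MemLp b ⊤ P) :
    TendstoWeakL2 P (fun i p => a p + w i p • b p) l (fun p => a p + u p • b p) := by
  intro g hg
  have hgb : MemLp (fun p => (inner ℝ (g p) (b p) : ℝ)) 2 P := memLp_inner hg hb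
  have hsplit {v : Ω → ℝ} (hv : MemLp v 2 P) : ∫ p, inner ℝ (g p) (a p + v p • b p) ∂P =
      ∫ p, inner ℝ (g p) (a p) ∂P + ∫ p, inner ℝ (inner ℝ (g p) (b p)) (v p) ∂P := by
    rw [← integral_add (memLp_one_iff_integrable.mp (memLp_inner hg ha))
      (memLp_one_iff_integrable.mp (memLp_inner hgb hv))]
    refine integral_congr_ae (Eventually.of_forall fun p => ?_)
    simp only [inner_add_right, real_inner_smul_right, RCLike.inner_apply, conj_trivial]
  simp only [hsplit (hw _), hsplit hu]
  exact (h _ hgb).const_add _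

lemma ae_eq_zero_of_cutNorm_eq_zero {I J : Type*} [MeasurableSpace I] [MeasurableSpace J]
    [CompleteSpace H] {μ : Measure I} {ν : Measure J} [IsFiniteMeasure μ] [IsFiniteMeasure ν]
    {f : I × J → H} (hf : Integrable f (μ.prod ν)) (h : cutNorm μ ν f = 0) :
    f =ᵐ[μ.prod ν] 0 := by
  have hrect {S : Set I} (hS : MeasurableSet S) {T : Set J} (hT : MeasurableSet T) :
      ∫ p in S ×ˢ T, f p ∂(μ.prod ν) = 0 :=
    enorm_eq_zero.mp (le_zero_iff.mp ((enorm_setIntegral_le_cutNorm f hS hT).trans_eq h))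
  have hset {A : Set (I × J)} (hA : MeasurableSet A) : ∫ p in A, f p ∂(μ.prod ν) = 0 := by
    induction A, hA using MeasurableSpace.induction_on_inter generateFrom_prod.symm
      isPiSystem_prod with
    | empty => exact setIntegral_empty
    | basic A hA =>
      obtain ⟨S, hS, T, hT, rfl⟩ := hA
      exact hrect hS hT
    | compl A hA ih =>
      have huniv := hrect .univ .univ
      rwa [Set.univ_prod_univ, setIntegral_univ, ← integral_add_compl hA hf, ih, zero_add]
        at huniv
    | iUnion A hd hA ih => simp only [integral_iUnion hA hd hf.integrableOn, ih, tsum_zero]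
  exact hf.ae_eq_zero_of_forall_setIntegral_eq_zero fun A hA _ => hset hA

variable {J : Type*} [MeasurableSpace J] {ν : Measure J} [IsProbabilityMeasure ν] {C : ℝ}

lemma TendstoWeakL2.pairKernel {w : ι → KernelsIn ν (weightInterval C)} {l : Filter ι}
    {w' : KernelsIn ν (weightInterval C)}
    (h : TendstoWeakL2 (ν.prod ν) (fun i => w i) l w') {Y : J → UnitAddCircle}
    (hY : Measurable Y) :
    TendstoWeakL2 (ν.prod ν) (fun i => pairKernel (w i) Y) l (pairKernel w' Y) := by
  have hconst (c : ℝ) : MemLp (fun p : J × J => pairValue (Y p.2, c)) ⊤ (ν.prod ν) :=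
    KernelsIn.memLp (KernelsIn.pair (C := |c|)
      ⟨fun _ => c, aestronglyMeasurable_const, Eventually.of_forall fun _ => abs_le.mp le_rfl⟩ hY) ⊤
  have hweak := h.const_add_smul (fun i => (w i).memLp 2) (w'.memLp 2)
    ((hconst 0).mono_exponent le_top) ((hconst 1).sub (hconst 0))
  simpa only [pairKernel_eq_pairValue, pairValue_eq_add_smul _ (KernelsIn.toFun _ _), Pi.sub_apply]
    using hweak

theorem exists_pair_of_tendsto_cutNorm (w : ℕ → KernelsIn ν (weightInterval C))
    {X : ℕ → J → UnitAddCircle} (hX : ∀ j, Measurable (X j))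
    {u : J × J → PiLp 2 (fun _ : Fin 2 => HNegOne)} (hu : Integrable u (ν.prod ν))
    (h : Tendsto (fun j => cutNorm ν ν (pairKernel (w j) (X j) - u)) atTop (𝓝 0)) :
    ∃ (w' : KernelsIn ν (weightInterval C)) (Y : J → UnitAddCircle), Measurable Y ∧
      u =ᵐ[ν.prod ν] pairKernel w' Y := by
  obtain ⟨ψ, hψ, Y, hY, hXY⟩ := exists_subseq_tendsto_position w hX hu h
  have hpair (v : KernelsIn ν (weightInterval C)) {Z : J → UnitAddCircle} (hZ : Measurable Z) :
      Integrable (pairKernel v Z) (ν.prod ν) := (v.pair hZ).integrable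
  have hlim : Tendsto (fun j => cutNorm ν ν (u - pairKernel (w (ψ j)) Y)) atTop (𝓝 0) := by
    have hsum := (h.comp hψ.tendsto_atTop).add
      (tendsto_cutNorm_pairKernel_sub (fun j => w (ψ j)) (fun j => hX (ψ j)) hXY)
    rw [add_zero] at hsum
    refine tendsto_of_tendsto_of_tendsto_of_le_of_le tendsto_const_nhds hsum (fun _ => zero_le)
      fun j => ?_
    rw [Function.comp_apply, cutNorm_sub_comm _ u]
    exact cutNorm_sub_le hu (hpair _ (hX (ψ j))) (hpair _ hY)
  obtain ⟨w', hw'⟩ := KernelsIn.exists_tendstoWeakL2 (K := weightInterval C) (convex_Icc (-C) C)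
    (hyperfilter ℕ) fun j => w (ψ j)
  have hzero : cutNorm ν ν (u - pairKernel w' Y) = 0 :=
    le_zero_iff.mp (((hw'.pairKernel hY).cutNorm_sub_le_liminf (fun j => hpair _ hY)
      (hpair w' hY) hu).trans_eq (hlim.mono_left Nat.hyperfilter_le_atTop).liminf_eq)
  exact ⟨w', Y, hY, (sub_ae_eq_zero _ _).mp
    (ae_eq_zero_of_cutNorm_eq_zero (hu.sub (hpair w' hY)) hzero)⟩

variable [StandardBorelSpace J] {I : ℕ → Type*} [∀ n, MeasurableSpace (I n)]
  [∀ n, StandardBorelSpace (I n)] {μ : ∀ n, Measure (I n)} [∀ n, IsProbabilityMeasure (μ n)]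

theorem exists_pair_of_tendsto_cutDist (w : ∀ n, KernelsIn (μ n) (weightInterval C))
    {X : ∀ n, I n → UnitAddCircle} (hX : ∀ n, Measurable (X n))
    {u : J × J → PiLp 2 (fun _ : Fin 2 => HNegOne)} (hu : Integrable u (ν.prod ν))
    (h : Tendsto (fun n => cutDist (μ n) ν (pairKernel (w n) (X n)) u) atTop (𝓝 0)) :
    ∃ (w' : KernelsIn ν (weightInterval C)) (Y : J → UnitAddCircle), Measurable Y ∧
      u =ᵐ[ν.prod ν] pairKernel w' Y := by
  choose n hn using fun j : ℕ =>
    (h.eventually (gt_mem_nhds (ENNReal.pow_pos (a := 2⁻¹) (by simp) j))).exists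
  choose θ hθ hθlt using fun j => exists_cutNorm_lt (hn j)
  have hcomap (j : ℕ) : cutNorm ν ν (pairKernel ((w (n j)).comap ((hθ j).symm _))
      (X (n j) ∘ (θ j).symm) - u) ≤ 2⁻¹ ^ j :=
    (cutNorm_sub_comp_symm (hθ j) (pairKernel (w (n j)) (X (n j))) u).trans_le (hθlt j).le
  exact exists_pair_of_tendsto_cutNorm (fun j => (w (n j)).comap ((hθ j).symm _))
    (X := fun j => X (n j) ∘ (θ j).symm) (fun j => (hX (n j)).comp (θ j).symm.measurable) hu
    (tendsto_of_tendsto_of_tendsto_of_le_of_le tendsto_const_nhds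
      (ENNReal.tendsto_pow_atTop_nhds_zero_of_lt_one (r := 2⁻¹) (by simp)) (fun _ => zero_le)
      hcomap)

end PairLimits

section Compactness

variable {I : ℕ → Type*} [∀ n, MeasurableSpace (I n)] [∀ n, StandardBorelSpace (I n)]
  {μ : ∀ n, Measure (I n)} [∀ n, IsProbabilityMeasure (μ n)] [∀ n, NullSingletonClass (μ n)]
  {J : Type*} [MeasurableSpace J] [StandardBorelSpace J]
  (ν : Measure J) [IsProbabilityMeasure ν] [NullSingletonClass ν]

theorem exists_subseq_tendsto_cutDist_of_isCompactOperator {B H : Type*} [NormedAddCommGroup B]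
    [NormedSpace ℝ B] [NormedAddCommGroup H] [InnerProductSpace ℝ H] [CompleteSpace H]
    {ι : B →L[ℝ] H} (hι : IsCompactOperator ι) {w : ∀ n, I n × I n → B} {R : ℝ}
    (hw : ∀ n, AEStronglyMeasurable (fun p => ι (w n p)) ((μ n).prod (μ n)))
    (hwR : ∀ n, ∀ᵐ p ∂((μ n).prod (μ n)), ‖w n p‖ ≤ R) :
    ∃ φ : ℕ → ℕ, StrictMono φ ∧ ∃ u : J × J → H,
      MemLp u ⊤ (ν.prod ν) ∧
      (∀ᵐ p ∂(ν.prod ν), u p ∈ closure (ι '' Metric.closedBall (0 : B) R)) ∧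
      Tendsto (fun k => cutDist (μ (φ k)) ν (fun p => ι (w (φ k) p)) u) atTop (𝓝 0) ∧
      (IsClosed (ι '' Metric.closedBall (0 : B) 1) →
        ∃ w' : J × J → B, MemLInfty ι (ν.prod ν) w' ∧ u =ᵐ[ν.prod ν] fun p => ι (w' p)) := by
  let K : TopologicalSpace.Compacts H :=
    ⟨closure (ι '' Metric.closedBall 0 R), hι.isCompact_closure_image_closedBall R⟩
  have hconv : Convex ℝ (K : Set H) :=
    ((convex_closedBall (0 : B) R).linear_image ι.toLinearMap).closure
  obtain ⟨φ, hφ, u, hlim⟩ := exists_subseq_tendsto_cutDist μ ν hconv fun n =>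
    ⟨fun p => ι (w n p), hw n, (hwR n).mono fun p hp =>
      subset_closure ⟨w n p, mem_closedBall_zero_iff.mpr hp, rfl⟩⟩
  exact ⟨φ, hφ, u, u.memLp ⊤, u.ae_mem, hlim,
    fun hclosed => exists_memLInfty_lift hclosed u.aestronglyMeasurable u.ae_mem⟩

theorem exists_subseq_tendsto_cutDist_pairKernel {C : ℝ}
    (w : ∀ n, KernelsIn (μ n) (weightInterval C)) {X : ∀ n, I n → UnitAddCircle}
    (hX : ∀ n, Measurable (X n)) :
    ∃ φ : ℕ → ℕ, StrictMono φ ∧ ∃ (w' : KernelsIn ν (weightInterval C)) (Y : J → UnitAddCircle),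
      Measurable Y ∧ Tendsto (fun k => cutDist (μ (φ k)) ν (pairKernel (w (φ k)) (X (φ k)))
        (pairKernel w' Y)) atTop (𝓝 0) := by
  obtain ⟨φ, hφ, u, hlim⟩ :=
    exists_subseq_tendsto_cutDist μ ν (convex_pairHull C) fun n => (w n).pair (hX n)
  obtain ⟨w', Y, hY, hu⟩ :=
    exists_pair_of_tendsto_cutDist (fun k => w (φ k)) (fun k => hX (φ k)) u.integrable hlim
  exact ⟨φ, hφ, w', Y, hY, hlim.congr fun k => cutDist_congr_right _ hu⟩

end Compactness

end CutCompactness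

end

theorem lemma2p14_general
    {I : ℕ → Type*} [∀ n, MeasurableSpace (I n)] [∀ n, StandardBorelSpace (I n)]
    (μ : ∀ n, Measure (I n)) [∀ n, IsProbabilityMeasure (μ n)] [∀ n, NullSingletonClass (μ n)]
    {J : Type*} [MeasurableSpace J] [StandardBorelSpace J]
    (ν : Measure J) [IsProbabilityMeasure ν] [NullSingletonClass ν]
    {B : Type*} [NormedAddCommGroup B] [NormedSpace ℝ B]
    {H : Type*} [NormedAddCommGroup H] [InnerProductSpace ℝ H] [CompleteSpace H]
    (ι : B →L[ℝ] H) (hι : IsCompactOperator ι) :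
    (∀ (w : ∀ n, I n × I n → B) (wmax : ℝ),
      (∀ n, AEStronglyMeasurable (fun p => ι (w n p)) ((μ n).prod (μ n))) →
      (∀ n, ∀ᵐ p ∂((μ n).prod (μ n)), ‖w n p‖ ≤ wmax) →
      ∃ φ : ℕ → ℕ, StrictMono φ ∧ ∃ u : J × J → H,
        MemLp u ⊤ (ν.prod ν) ∧
        (∀ᵐ p ∂(ν.prod ν), u p ∈ closure (ι '' Metric.closedBall (0 : B) wmax)) ∧
        Tendsto (fun k => CutCompactness.cutDist (μ (φ k)) ν (fun p => ι (w (φ k) p)) u)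
          atTop (𝓝 0) ∧
        (IsClosed (ι '' Metric.closedBall (0 : B) 1) →
          ∃ wlim : J × J → B, CutCompactness.MemLInfty ι (ν.prod ν) wlim ∧
            u =ᵐ[ν.prod ν] fun p => ι (wlim p))) ∧
    (∀ (w : ∀ n, I n × I n → ℝ) (X : ∀ n, I n → UnitAddCircle) (wmax : ℝ),
      (∀ n, AEStronglyMeasurable (w n) ((μ n).prod (μ n))) →
      (∀ n, ∀ᵐ p ∂((μ n).prod (μ n)), |w n p| ≤ wmax) →
      (∀ n, Measurable (X n)) →
      (∃ φ : ℕ → ℕ, StrictMono φ ∧ ∃ (wlim : J × J → ℝ) (Xlim : J → UnitAddCircle),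
        MemLp wlim ⊤ (ν.prod ν) ∧ Measurable Xlim ∧
        Tendsto (fun k => CutCompactness.cutDist (μ (φ k)) ν
          (CutCompactness.pairKernel (w (φ k)) (X (φ k)))
          (CutCompactness.pairKernel wlim Xlim)) atTop (𝓝 0)) ∧
      (∀ (φ : ℕ → ℕ) (u : J × J → PiLp 2 (fun _ : Fin 2 => CutCompactness.HNegOne)),
        Integrable u (ν.prod ν) →
        Tendsto (fun k => CutCompactness.cutDist (μ (φ k)) ν
          (CutCompactness.pairKernel (w (φ k)) (X (φ k))) u) atTop (𝓝 0) →
        ∃ (wlim : J × J → ℝ) (Xlim : J → UnitAddCircle),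
          MemLp wlim ⊤ (ν.prod ν) ∧ Measurable Xlim ∧
          u =ᵐ[ν.prod ν] CutCompactness.pairKernel wlim Xlim)) := by
  refine ⟨fun w wmax hw hwmax =>
    CutCompactness.exists_subseq_tendsto_cutDist_of_isCompactOperator ν hι hw hwmax,
    fun w X wmax hw hwmax hX => ?_⟩
  let v (n : ℕ) : CutCompactness.KernelsIn (μ n) (CutCompactness.weightInterval wmax) :=
    ⟨w n, hw n, (hwmax n).mono fun p hp => abs_le.mp hp⟩
  refine ⟨?_, fun φ u hu hlim => ?_⟩
  · obtain ⟨φ, hφ, w', Y, hY, hlim⟩ :=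
      CutCompactness.exists_subseq_tendsto_cutDist_pairKernel ν v hX
    exact ⟨φ, hφ, w', Y, w'.memLp ⊤, hY, hlim⟩
  · obtain ⟨w', Y, hY, huw'⟩ := CutCompactness.exists_pair_of_tendsto_cutDist
      (fun k => v (φ k)) (fun k => hX (φ k)) hu hlim
    exact ⟨w', Y, w'.memLp ⊤, hY, huw'⟩

theorem lemma2p14
    {I : ℕ → Type*} [∀ n, MeasurableSpace (I n)] [∀ n, StandardBorelSpace (I n)]
    (μ : ∀ n, Measure (I n)) [∀ n, IsProbabilityMeasure (μ n)] [∀ n, NullSingletonClass (μ n)]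
    {J : Type*} [MeasurableSpace J] [StandardBorelSpace J]
    (ν : Measure J) [IsProbabilityMeasure ν] [NullSingletonClass ν]
    {B : Type*} [NormedAddCommGroup B] [NormedSpace ℝ B] [CompleteSpace B]
    {H : Type*} [NormedAddCommGroup H] [InnerProductSpace ℝ H] [CompleteSpace H]
    [TopologicalSpace.SeparableSpace H]
    (ι : B →L[ℝ] H) (hι : CutCompactness.IsCompactEmbedding ι) :
    -- compactness for kernels with values in `B`
    (∀ (w : ∀ n, I n × I n → B) (wmax : ℝ),
      (∀ n, CutCompactness.MemLInfty ι ((μ n).prod (μ n)) (w n)) →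
      (∀ n, ∀ᵐ p ∂((μ n).prod (μ n)), ‖w n p‖ ≤ wmax) →
      ∃ φ : ℕ → ℕ, StrictMono φ ∧ ∃ u : J × J → H,
        MemLp u ⊤ (ν.prod ν) ∧
        (∀ᵐ p ∂(ν.prod ν), u p ∈ closure (ι '' Metric.closedBall (0 : B) wmax)) ∧
        Tendsto (fun k => CutCompactness.cutDist (μ (φ k)) ν (fun p => ι (w (φ k) p)) u)
          atTop (𝓝 0) ∧
        (IsClosed (ι '' Metric.closedBall (0 : B) 1) →
          ∃ wlim : J × J → B, CutCompactness.MemLInfty ι (ν.prod ν) wlim ∧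
            u =ᵐ[ν.prod ν] fun p => ι (wlim p))) ∧
    -- kernels that come from pairs
    (∀ (w : ∀ n, I n × I n → ℝ) (X : ∀ n, I n → UnitAddCircle) (wmax : ℝ),
      (∀ n, AEStronglyMeasurable (w n) ((μ n).prod (μ n))) →
      (∀ n, ∀ᵐ p ∂((μ n).prod (μ n)), |w n p| ≤ wmax) →
      (∀ n, Measurable (X n)) →
      -- some subsequence converges to the kernel of a pair
      (∃ φ : ℕ → ℕ, StrictMono φ ∧ ∃ (wlim : J × J → ℝ) (Xlim : J → UnitAddCircle),
        MemLp wlim ⊤ (ν.prod ν) ∧ Measurable Xlim ∧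
        Tendsto (fun k => CutCompactness.cutDist (μ (φ k)) ν
          (CutCompactness.pairKernel (w (φ k)) (X (φ k)))
          (CutCompactness.pairKernel wlim Xlim)) atTop (𝓝 0)) ∧
      -- every limit of a subsequence is the kernel of a pair
      (∀ φ : ℕ → ℕ, StrictMono φ →
        ∀ u : J × J → PiLp 2 (fun _ : Fin 2 => CutCompactness.HNegOne),
        MemLp u ⊤ (ν.prod ν) →
        Tendsto (fun k => CutCompactness.cutDist (μ (φ k)) ν
          (CutCompactness.pairKernel (w (φ k)) (X (φ k))) u) atTop (𝓝 0) →
        ∃ (wlim : J × J → ℝ) (Xlim : J → UnitAddCircle),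
          MemLp wlim ⊤ (ν.prod ν) ∧ Measurable Xlim ∧
          u =ᵐ[ν.prod ν] CutCompactness.pairKernel wlim Xlim)) := by
  have ⟨hkernel, hpair⟩ := lemma2p14_general μ ν ι hι.compact
  exact ⟨fun w wmax hw => hkernel w wmax fun n => (hw n).measurable, fun w X wmax hw hwmax hX =>
    (hpair w X wmax hw hwmax hX).imp_right fun h φ _ u hu => h φ u (hu.integrable le_top)⟩
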